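/- **Setting.** Let $(\Omega,\mathcal F)$ be a measurable space, let $X\subseteq\mathbb R^n$ be compact, let $\Theta\subseteq\mathbb R^d$ be convex and open relative to its affine hull, and let $\mathbb P_\theta$ be a probability measure on $(\Omega,\mathcal F)$ for every $\theta\in\Theta$. Let $\{\xi_t\}_{t\ge 1}$ be a stochastic process valued in $\mathbb R^m$ on $(\Omega,\mathcal F)$, let $\mathcal F_T=\sigma(\xi_1,\dots,\xi_T)$, and let $\mathbb P^T_\theta$ be the restriction of $\mathbb P_\theta$ to $\mathcal F_T$; throughout $T$ ranges over $\{1,2,\dots\}$. Let $c:X\times\Theta\to\mathbb R$ be uniformly continuous and bounded; its unique continuous extension to $X\times\operatorname{cl}\Theta$ is denoted by $c$, too. **Statistic.** Let $\widehat S=\{\widehat S_T\}$ be a statistic: an $\{\mathcal F_T\}$-adapted process in $\mathbb R^d$ whose state space $\mathbb S$ is the smallest closed set with $\mathbb P_\theta[\widehat S_T\in\mathbb S]=1$ for all $\theta\in\Theta$ and $T$, and for which there is a local homeomorphism $S_\infty:\Theta\to\mathbb S$ (subspace topologies) such that $\widehat S_T\to S_\infty(\theta)$ in probability under $\mathbb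 P_\theta$ for every $\theta\in\Theta$. Put $\mathbb S_\infty=S_\infty(\Theta)$ and $\Lambda_T(\lambda,\theta)=\log\mathbb E_\theta[\exp\langle\lambda,\widehat S_T\rangle]\in(-\infty,\infty]$. **Assumptions.** 1. (Time-homogeneous exponential family.) There are $\bar\theta\in\Theta$ and a continuous $g:\Theta\to\mathbb R^d$ such that, with $A_T(\lambda)=\Lambda_T(\lambda,\bar\theta)$, for all $T$ and $\theta\in\Theta$ we have $A_T(Tg(\theta))<\infty$ and $$\frac{\mathrm d\mathbb P^T_\theta}{\mathrm d\mathbb P^T_{\bar\theta}}=\exp\big(\langle Tg(\theta),\widehat S_T\rangle-A_T(Tg(\theta))\big).$$ 2. (Gärtner–Ellis conditions.) $\Lambda_T(\lambda,\theta)<\infty$ for all $\lambda\in\mathbb R^d$, $\theta\in\Theta$ and $T$; the limit $\Lambda(\lambda,\theta)=\lim_{T\to\infty}\frac1T\Lambda_T(T\lambda,\theta)\in(-\infty,\infty]$ exists for all $\lambda\in\mathbb R^d$ and $\theta\in\Theta$; and for every $\theta\in\Theta$, writing $\operatorname{dom}\Lambda(\cdot,\theta)=\{\lambda:\Lambda(\lambda,\theta)<\infty\}$,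 the origin is an interior point of $\operatorname{dom}\Lambda(\cdot,\theta)$, the function $\Lambda(\cdot,\theta)$ is differentiable on the interior of $\operatorname{dom}\Lambda(\cdot,\theta)$, and $\|\nabla_\lambda\Lambda(\lambda,\theta)\|\to\infty$ as $\lambda$ tends, within this interior, to a boundary point of $\operatorname{dom}\Lambda(\cdot,\theta)$. 3. (Regular rate function.) $I:\mathbb S\times\operatorname{cl}\Theta\to[0,\infty]$ satisfies $I(s,\theta)=\sup_{\lambda\in\mathbb R^d}\{\langle\lambda,s\rangle-\Lambda(\lambda,\theta)\}$ for all $(s,\theta)\in\mathbb S\times\Theta$ and is a regular rate function: $I(\cdot,\theta)$ is lower semicontinuous on $\mathbb S$ for every $\theta\in\operatorname{cl}\Theta$; $\operatorname{cl}\{\theta\in\Theta:I(s,\theta)<\rho\}=\{\theta\in\operatorname{cl}\Theta:I(s,\theta)\le\rho\}$ for all $s\in\mathbb S_\infty$ and $\rho>0$; $I$ is continuous on $\mathbb S\times\Theta$; and $\{(s,\theta)\in\mathbb S\times\operatorname{cl}\Theta:I(s,\theta)\le\rho\}$ is compact for every $\rho\ge0$. **Data-driven predictors.** A family $\widehat c=\{\widehat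 c_T(x)\}_{T,\,x\in X}$ of real random variables is a data-driven predictor if (i) $\widehat c_T(x)$ is continuous in $x\in X$; (ii) $\widehat c_T(x)$ is $\mathcal F_T$-measurable; (iii) there is a random variable $\bar c\ge0$ with $\mathbb E_\theta[\bar c]<\infty$ for all $\theta\in\Theta$ and $|\widehat c_T(x)|\le\bar c$ $\mathbb P_\theta$-almost surely for all $T$, $x\in X$ and $\theta\in\Theta$; (iv) there is a Borel function $c_\infty:X\times\Theta\to\mathbb R$ such that $\widehat c_T(x)\to c_\infty(x,\theta)$ in probability under $\mathbb P_\theta$ for all $x\in X$ and $\theta\in\Theta$; (v) there is a Borel function $v_\infty:\Theta\to\mathbb R$ such that $\min_{x\in X}\widehat c_T(x)\to v_\infty(\theta)$ in probability under $\mathbb P_\theta$ for all $\theta\in\Theta$. Let $r>0$. A data-driven predictor $\widehat c$ is feasible if $$\limsup_{T\to\infty}\frac1T\log\mathbb P_\theta[c(x,\theta)>\widehat c_T(x)]\le-r\qquad\text{for all }x\in X,\ \theta\in\Theta.$$ **Theorem (Optimality of $\widehat c^{\,\star}$).** Let $$\tilde c^\star(x,s)=\begin{cases}\max\{c(x,\theta):\theta\in\operatorname{cl}\Theta,\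 I(s,\theta)\le r\}&\text{if some }\theta\in\operatorname{cl}\Theta\text{ has }I(s,\theta)\le r,\\ \sup_{\theta\in\operatorname{cl}\Theta}c(x,\theta)&\text{otherwise}\end{cases}$$ for $x\in X$ and $s\in\mathbb S$ (with the value of the second case for $s\notin\mathbb S$), and let $\widehat c^{\,\star}_T(x)=\tilde c^\star(x,\widehat S_T)$. Under the above assumptions, $\widehat c^{\,\star}$ is a feasible data-driven predictor, and it Pareto dominates every feasible data-driven predictor $\widehat c$: for all $x\in X$ and $\theta\in\Theta$ the limits below exist and $$\lim_{T\to\infty}\mathbb E_\theta[\widehat c^{\,\star}_T(x)]\le\lim_{T\to\infty}\mathbb E_\theta[\widehat c_T(x)].$$ -/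

import Mathlib

open MeasureTheory Filter Topology Set
open scoped ENNReal

namespace DataDriven

/-- The Euclidean space `ℝᵏ`. -/
abbrev Euc (k : ℕ) : Type := EuclideanSpace ℝ (Fin k)

/-! ### The data, the models and the model-based cost -/

/-- The σ-algebra `ℱ_T` generated by the history `ξ_1, …, ξ_T` of the data-generating process.
Time starts at `1`; the variable `ξ 0` is never used. -/
@[reducible] def history {Ω : Type*} {m : ℕ} (ξ : ℕ → Ω → Euc m) (T : ℕ) : MeasurableSpace Ω :=
  ⨆ t ∈ Finset.Icc 1 T, MeasurableSpace.comap (ξ t) inferInstance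

theorem history_le {Ω : Type*} [mΩ : MeasurableSpace Ω] {m : ℕ} {ξ : ℕ → Ω → Euc m}
    (hξ : ∀ t, Measurable (ξ t)) (T : ℕ) : history ξ T ≤ mΩ :=
  iSup₂_le fun t _ => (hξ t).comap_le

/-- A finitely parametrized ambiguity set `{P_θ : θ ∈ Θ}`: the model space `Θ ⊆ ℝᵈ` is convex and
open relative to its affine hull, and every `P_θ` with `θ ∈ Θ` is a probability measure. -/
structure IsAmbiguitySet {Ω : Type*} [MeasurableSpace Ω] {d : ℕ} (Θ : Set (Euc d))
    (P : Euc d → Measure Ω) : Prop where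
  convex : Convex ℝ Θ
  relativelyOpen : intrinsicInterior ℝ Θ = Θ
  isProbabilityMeasure : ∀ θ ∈ Θ, IsProbabilityMeasure (P θ)

/-- The model-based predictor `c` is uniformly continuous and bounded on `X × Θ`. -/
structure IsModelPredictor {n d : ℕ} (X : Set (Euc n)) (Θ : Set (Euc d))
    (c : Euc n → Euc d → ℝ) : Prop where
  uniformContinuousOn : UniformContinuousOn (fun p : Euc n × Euc d => c p.1 p.2) (X ×ˢ Θ)
  bounded : ∃ M : ℝ, ∀ x ∈ X, ∀ θ ∈ Θ, |c x θ| ≤ M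

/-- The extension of `c` by continuity from `X × Θ` to `X × cl Θ`. -/
noncomputable def extendedCost {n d : ℕ} (X : Set (Euc n)) (Θ : Set (Euc d))
    (c : Euc n → Euc d → ℝ) (x : Euc n) (θ : Euc d) : ℝ :=
  extendFrom (X ×ˢ Θ) (fun p : Euc n × Euc d => c p.1 p.2) (x, θ)

/-! ### Data-driven predictors and the meta-optimization problem -/

/-- Data-driven predictors `ĉ = {ĉ_T(x)}`, written `chat T x ω`. -/
structure IsDataDrivenPredictor {Ω : Type*} [MeasurableSpace Ω] {n m d : ℕ}
    (X : Set (Euc n)) (Θ : Set (Euc d)) (ξ : ℕ → Ω → Euc m) (P : Euc d → Measure Ω)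
    (chat : ℕ → Euc n → Ω → ℝ) : Prop where
  /-- Continuity in the decisions. -/
  continuousOn : ∀ T, 1 ≤ T → ∀ ω, ContinuousOn (fun x => chat T x ω) X
  /-- Non-anticipativity. -/
  adapted : ∀ T, 1 ≤ T → ∀ x ∈ X, Measurable[history ξ T] (chat T x)
  /-- Uniform integrability. -/
  dominated : ∃ cbar : Ω → ℝ, Measurable cbar ∧ (∀ ω, 0 ≤ cbar ω) ∧
    (∀ θ ∈ Θ, Integrable cbar (P θ)) ∧
    ∀ T, 1 ≤ T → ∀ x ∈ X, ∀ θ ∈ Θ, ∀ᵐ ω ∂(P θ), |chat T x ω| ≤ cbar ω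
  /-- Convergence of the objective, in probability. -/
  objective_converges : ∃ cinf : Euc n → Euc d → ℝ,
    (Measurable fun p : X × Θ => cinf p.1 p.2) ∧
    ∀ x ∈ X, ∀ θ ∈ Θ,
      TendstoInMeasure (P θ) (fun T => chat T x) atTop (fun _ => cinf x θ)
  /-- Convergence of the optimal value, in probability. -/
  value_converges : ∃ vinf : Euc d → ℝ,
    (Measurable fun θ : Θ => vinf θ) ∧
    ∀ θ ∈ Θ,
      TendstoInMeasure (P θ) (fun T ω => ⨅ x : X, chat T x ω) atTop (fun _ => vinf θ)

/-- The feasible solutions of the meta-optimization problem: data-driven predictors whose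
out-of-sample disappointment satisfies
`limsup_{T → ∞} (1 / T) log P_θ[c(x, θ) > ĉ_T(x)] ≤ -r` for all `x ∈ X` and `θ ∈ Θ`. -/
structure IsFeasible {Ω : Type*} [MeasurableSpace Ω] {n m d : ℕ}
    (X : Set (Euc n)) (Θ : Set (Euc d)) (ξ : ℕ → Ω → Euc m) (P : Euc d → Measure Ω)
    (c : Euc n → Euc d → ℝ) (r : ℝ) (chat : ℕ → Euc n → Ω → ℝ) : Prop where
  predictor : IsDataDrivenPredictor X Θ ξ P chat
  disappointment : ∀ x ∈ X, ∀ θ ∈ Θ,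
    limsup (fun T : ℕ => ((1 / (T : ℝ) : ℝ) : EReal) *
      ENNReal.log (P θ {ω | chat T x ω < c x θ})) atTop ≤ ((-r : ℝ) : EReal)

/-- Pareto dominant solutions of the meta-optimization problem that minimizes the asymptotic
expected in-sample risks `lim_{T → ∞} E_θ[ĉ_T(x)]`, for all `x ∈ X` and `θ ∈ Θ` simultaneously,
over the feasible data-driven predictors. The existence of the limits is part of the claim. -/
structure IsParetoDominant {Ω : Type*} [MeasurableSpace Ω] {n m d : ℕ}
    (X : Set (Euc n)) (Θ : Set (Euc d)) (ξ : ℕ → Ω → Euc m) (P : Euc d → Measure Ω)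
    (c : Euc n → Euc d → ℝ) (r : ℝ) (cstar : ℕ → Euc n → Ω → ℝ) : Prop where
  feasible : IsFeasible X Θ ξ P c r cstar
  dominates : ∀ chat : ℕ → Euc n → Ω → ℝ, IsFeasible X Θ ξ P c r chat →
    ∀ x ∈ X, ∀ θ ∈ Θ, ∃ a b : ℝ,
      Tendsto (fun T : ℕ => ∫ ω, cstar T x ω ∂(P θ)) atTop (𝓝 a) ∧
      Tendsto (fun T : ℕ => ∫ ω, chat T x ω ∂(P θ)) atTop (𝓝 b) ∧ a ≤ b

/-! ### Statistics and exponential families -/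

/-- `S = {Ŝ_T}` is a statistic with state space `𝕊` and limit map `Sinf`. The state space is the
smallest closed set that contains every `Ŝ_T` almost surely under every model, and `Sinf` is a local
homeomorphism from `Θ` to `𝕊` (both with the subspace topology). -/
structure IsStatistic {Ω : Type*} [MeasurableSpace Ω] {m d : ℕ}
    (Θ : Set (Euc d)) (ξ : ℕ → Ω → Euc m) (P : Euc d → Measure Ω)
    (S : ℕ → Ω → Euc d) (𝕊 : Set (Euc d)) (Sinf : Euc d → Euc d) : Prop where
  adapted : ∀ T, 1 ≤ T → Measurable[history ξ T] (S T)
  stateSpace : IsLeast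
    {F : Set (Euc d) | IsClosed F ∧ ∀ θ ∈ Θ, ∀ T, 1 ≤ T → ∀ᵐ ω ∂(P θ), S T ω ∈ F} 𝕊
  localHomeomorph : ∃ h : MapsTo Sinf Θ 𝕊, IsLocalHomeomorph (h.restrict Sinf Θ 𝕊)
  converges : ∀ θ ∈ Θ, TendstoInMeasure (P θ) S atTop (fun _ => Sinf θ)

/-- The log-moment generating function `l ↦ log E_μ[exp ⟨l, Y⟩]`, equal to `+∞` where the
expectation is infinite. -/
noncomputable def logMGF {Ω : Type*} [MeasurableSpace Ω] {d : ℕ} (μ : Measure Ω)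
    (Y : Ω → Euc d) (l : Euc d) : EReal :=
  ENNReal.log (∫⁻ ω, ENNReal.ofReal (Real.exp (inner ℝ l (Y ω))) ∂μ)

/-- `{P_θ : θ ∈ Θ}` is a time-homogeneous exponential family with statistic `S`: for a baseline
model `θbar`, a continuous map `g` and the log-partition functions `A_T = logMGF (P θbar) (S T)`,
the points `T g(θ)` lie in the effective domain of `A_T`, and on `ℱ_T` the measure `P_θ` has the
density `exp (⟨T g(θ), Ŝ_T⟩ - A_T (T g(θ)))` with respect to `P_θbar`. -/
def IsExponentialFamily {Ω : Type*} [MeasurableSpace Ω] {m d : ℕ}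
    (Θ : Set (Euc d)) (ξ : ℕ → Ω → Euc m) (hξ : ∀ t, Measurable (ξ t))
    (P : Euc d → Measure Ω) (S : ℕ → Ω → Euc d) : Prop :=
  ∃ θbar ∈ Θ, ∃ g : Euc d → Euc d, ContinuousOn g Θ ∧
    ∀ T : ℕ, 1 ≤ T → ∀ θ ∈ Θ,
      logMGF (P θbar) (S T) ((T : ℝ) • g θ) < ⊤ ∧
      (P θ).trim (history_le hξ T) =
        ((P θbar).trim (history_le hξ T)).withDensity fun ω =>
          ENNReal.ofReal (Real.exp (inner ℝ ((T : ℝ) • g θ) (S T ω) -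
            (logMGF (P θbar) (S T) ((T : ℝ) • g θ)).toReal))

/-- The conditions of Gärtner–Ellis type on the log-moment generating functions of the statistic,
where `Λ l θ` is the limiting log-moment generating function. -/
structure HasLimitingLogMGF {Ω : Type*} [MeasurableSpace Ω] {d : ℕ}
    (Θ : Set (Euc d)) (P : Euc d → Measure Ω) (S : ℕ → Ω → Euc d)
    (Λ : Euc d → Euc d → EReal) : Prop where
  finite : ∀ T, 1 ≤ T → ∀ θ ∈ Θ, ∀ l, logMGF (P θ) (S T) l < ⊤
  tendsto : ∀ θ ∈ Θ, ∀ l, Tendsto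
    (fun T : ℕ => ((1 / (T : ℝ) : ℝ) : EReal) * logMGF (P θ) (S T) ((T : ℝ) • l))
    atTop (𝓝 (Λ l θ))
  ne_bot : ∀ θ ∈ Θ, ∀ l, Λ l θ ≠ ⊥
  zero_mem : ∀ θ ∈ Θ, (0 : Euc d) ∈ interior {l | Λ l θ < ⊤}
  differentiableAt : ∀ θ ∈ Θ, ∀ l ∈ interior {l | Λ l θ < ⊤},
    DifferentiableAt ℝ (fun l => (Λ l θ).toReal) l
  steep : ∀ θ ∈ Θ, ∀ l₀ ∈ frontier {l | Λ l θ < ⊤},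
    Tendsto (fun l => ‖gradient (fun l => (Λ l θ).toReal) l‖)
      (𝓝[interior {l | Λ l θ < ⊤}] l₀) atTop

/-! ### Regular rate functions and the distributionally robust predictor -/

/-- The sublevel set `{(s, θ) ∈ 𝕊 × cl Θ : I(s, θ) ≤ r}`. -/
def sublevel {d : ℕ} (𝕊 Θ : Set (Euc d)) (I : Euc d → Euc d → ℝ≥0∞) (r : ℝ) :
    Set (Euc d × Euc d) :=
  {p | p ∈ 𝕊 ×ˢ closure Θ ∧ I p.1 p.2 ≤ ENNReal.ofReal r}

/-- `I : 𝕊 × cl Θ → [0, ∞]` is a regular rate function (values of `I` outside `𝕊 × cl Θ` are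
irrelevant). The set of asymptotic realizations of the statistic is `Sinf '' Θ`. -/
structure IsRegularRateFunction {d : ℕ} (𝕊 Θ : Set (Euc d)) (Sinf : Euc d → Euc d)
    (I : Euc d → Euc d → ℝ≥0∞) : Prop where
  lowerSemicontinuousOn : ∀ θ ∈ closure Θ, LowerSemicontinuousOn (fun s => I s θ) 𝕊
  radiallyMonotone : ∀ s ∈ Sinf '' Θ, ∀ r : ℝ, 0 < r →
    closure {θ | θ ∈ Θ ∧ I s θ < ENNReal.ofReal r} =
      {θ | θ ∈ closure Θ ∧ I s θ ≤ ENNReal.ofReal r}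
  continuousOn : ContinuousOn (fun p : Euc d × Euc d => I p.1 p.2) (𝕊 ×ˢ Θ)
  levelCompact : ∀ r : ℝ, 0 ≤ r → IsCompact (sublevel 𝕊 Θ I r)

/-- `I` is an extension to `𝕊 × cl Θ` of the convex conjugate
`(s, θ) ↦ sup_l (⟨l, s⟩ - Λ(l, θ))`, which is defined for `θ ∈ Θ` only. -/
def IsConjugate {d : ℕ} (𝕊 Θ : Set (Euc d)) (Λ : Euc d → Euc d → EReal)
    (I : Euc d → Euc d → ℝ≥0∞) : Prop :=
  ∀ s ∈ 𝕊, ∀ θ ∈ Θ, (I s θ : EReal) = ⨆ l : Euc d, ((inner ℝ l s : ℝ) : EReal) - Λ l θ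

open Classical in
/-- The distributionally robust predictor `c̃⋆(x, s)`: the worst case of `c(x, θ)` over all
`θ ∈ cl Θ` with `I(s, θ) ≤ r` if there is such a `θ`, and over all `θ ∈ cl Θ` otherwise. The second
case also covers the points `s ∉ 𝕊`, which the statistic visits with probability zero. -/
noncomputable def robustPredictor {n d : ℕ} (X : Set (Euc n)) (𝕊 Θ : Set (Euc d))
    (c : Euc n → Euc d → ℝ) (I : Euc d → Euc d → ℝ≥0∞) (r : ℝ) (x : Euc n) (s : Euc d) : ℝ :=
  if ∃ θ, (s, θ) ∈ sublevel 𝕊 Θ I r then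
    sSup (extendedCost X Θ c x '' {θ | (s, θ) ∈ sublevel 𝕊 Θ I r})
  else
    sSup (extendedCost X Θ c x '' closure Θ)

end DataDriven

/-! ### Inequalities on the exponential scale. -/

namespace DataDriven

/-! Under `P θ` the statistic converges to `Sinf θ`, where the rate `I · θ` vanishes by a Chernoff
bound. Near such a point the set of models with rate at most `r` varies continuously: compact level
sets prevent it from jumping outwards, and radial monotonicity together with continuity of `I`
prevents it from collapsing. So the robust predictor is continuous there, and its expectation
converges to its value at `Sinf θ`.

Feasibility: for a statistic in `𝕊`, disappointment means that `θ` is outside the ambiguity set.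
This forces the statistic into a compact set on which `I · θ` is at least `r`, and the large
deviation upper bound `eventually_measure_compact_lt` applies. The worst case over all models, used
when no model has rate at most `r`, is what makes this set compact.

Optimality (`IsFeasible.robustPredictor_le`): suppose a feasible predictor had a limit `b` under
`θ₀` below the robust value. Some `θ₁ ∈ Θ` with `I (Sinf θ₀) θ₁ < r` then has `b < c x θ₁`. The
event that the predictor lies below `c x θ₁` is likely under `θ₀`. By the exponential family
identity `exists_changeOfMeasure`, moving it to `θ₁` costs an exponential rate smaller than `r`,
which contradicts feasibility at `θ₁`. The tilt `g θ₀ - g θ₁` does not depend on `T`, so the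
conjugate inequality at this single vector suffices and no large deviation lower bound is needed. -/

theorem log_eq_coe_of_ne {p : ℝ≥0∞} (h0 : p ≠ 0) (h1 : p ≠ ⊤) :
    ∃ u : ℝ, p = ENNReal.ofReal (Real.exp u) ∧ ENNReal.log p = (u : EReal) := by
  refine ⟨Real.log p.toReal, ?_, ENNReal.log_pos_real h0 h1⟩
  rw [Real.exp_log (ENNReal.toReal_pos h0 h1), ENNReal.ofReal_toReal h1]

/-- Decay rates are stated in `EReal`, but products and sums of measures live in `ℝ≥0∞`; this and
the next lemma translate between them. At `T = 0` the prefactor would be `0`, hence `1 ≤ T`. -/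
theorem scaledLog_lt_iff {T : ℕ} (hT : 1 ≤ T) (p : ℝ≥0∞) (y : ℝ) :
    ((1 / (T : ℝ) : ℝ) : EReal) * ENNReal.log p < (y : EReal) ↔
      p < ENNReal.ofReal (Real.exp (T * y)) := by
  have hT' : (0 : ℝ) < T := by exact_mod_cast hT
  rcases eq_or_ne p 0 with rfl | h0
  · simp [EReal.coe_mul_bot_of_pos (one_div_pos.2 hT'), Real.exp_pos, -one_div]
  rcases eq_or_ne p ⊤ with rfl | h1
  · simp [EReal.coe_mul_top_of_pos (one_div_pos.2 hT'), -one_div]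
  obtain ⟨u, rfl, hu⟩ := log_eq_coe_of_ne h0 h1
  rw [hu, ← EReal.coe_mul, EReal.coe_lt_coe_iff, ENNReal.ofReal_lt_ofReal_iff (Real.exp_pos _),
    Real.exp_lt_exp, one_div_mul_eq_div, div_lt_iff₀' hT']

theorem lt_scaledLog_iff {T : ℕ} (hT : 1 ≤ T) (p : ℝ≥0∞) (y : ℝ) :
    (y : EReal) < ((1 / (T : ℝ) : ℝ) : EReal) * ENNReal.log p ↔
      ENNReal.ofReal (Real.exp (T * y)) < p := by
  have hT' : (0 : ℝ) < T := by exact_mod_cast hT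
  rcases eq_or_ne p 0 with rfl | h0
  · simp [EReal.coe_mul_bot_of_pos (one_div_pos.2 hT'), -one_div]
  rcases eq_or_ne p ⊤ with rfl | h1
  · simp [EReal.coe_mul_top_of_pos (one_div_pos.2 hT'), -one_div]
  obtain ⟨u, rfl, hu⟩ := log_eq_coe_of_ne h0 h1
  rw [hu, ← EReal.coe_mul, EReal.coe_lt_coe_iff, ENNReal.ofReal_lt_ofReal_iff (Real.exp_pos _),
    Real.exp_lt_exp, one_div_mul_eq_div, lt_div_iff₀' hT']

theorem eventually_const_lt_exp {y : ℝ} (hy : 0 < y) {C : ℝ≥0∞} (hC : C ≠ ⊤) :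
    ∀ᶠ T : ℕ in atTop, C < ENNReal.ofReal (Real.exp (T * y)) := by
  have h : Tendsto (fun T : ℕ => Real.exp (T * y)) atTop atTop :=
    Real.tendsto_exp_atTop.comp (tendsto_natCast_atTop_atTop.atTop_mul_const hy)
  filter_upwards [h.eventually_gt_atTop C.toReal] with T hT
  exact (ENNReal.lt_ofReal_iff_toReal_lt hC).2 hT

theorem ofReal_exp_add (a b : ℝ) : ENNReal.ofReal (Real.exp (a + b)) =
    ENNReal.ofReal (Real.exp a) * ENNReal.ofReal (Real.exp b) := by
  rw [Real.exp_add, ENNReal.ofReal_mul (Real.exp_pos _).le]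

theorem ofReal_exp_ne_zero (a : ℝ) : ENNReal.ofReal (Real.exp a) ≠ 0 := by
  simp [Real.exp_pos]

/-! ### Chernoff bounds and the large deviation upper bound. -/

section LogMGF

variable {Ω : Type*} [MeasurableSpace Ω] {d : ℕ} {μ : Measure Ω} {S : ℕ → Ω → Euc d}

/-- The measures of half spaces decay at the rate of the Chernoff bound. -/
theorem eventually_measure_halfSpace_le (hSm : ∀ T, 1 ≤ T → Measurable (S T)) {l : Euc d}
    {Λl : EReal} (hΛ : Tendsto
      (fun T : ℕ => ((1 / (T : ℝ) : ℝ) : EReal) * logMGF μ (S T) ((T : ℝ) • l)) atTop (𝓝 Λl))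
    {L : ℝ} (hL : Λl < L) (a : ℝ) :
    ∀ᶠ T : ℕ in atTop, μ {ω | a ≤ inner ℝ l (S T ω)} ≤
      ENNReal.ofReal (Real.exp (T * (L - a))) := by
  filter_upwards [hΛ.eventually_lt_const hL, eventually_ge_atTop 1] with T h hT
  rw [logMGF, scaledLog_lt_iff hT] at h
  have hm : Measurable fun ω => ENNReal.ofReal (Real.exp (inner ℝ ((T : ℝ) • l) (S T ω))) := by
    have := hSm T hT
    fun_prop
  have hsub : {ω | a ≤ inner ℝ l (S T ω)} ⊆ {ω | ENNReal.ofReal (Real.exp (T * a)) ≤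
      ENNReal.ofReal (Real.exp (inner ℝ ((T : ℝ) • l) (S T ω)))} := by
    intro ω hω
    simp only [mem_ofPred_eq] at hω ⊢
    rw [real_inner_smul_left]
    gcongr
  have := (mul_le_mul_right (measure_mono hsub) _).trans
    ((mul_meas_ge_le_lintegral₀ hm.aemeasurable (ENNReal.ofReal (Real.exp (T * a)))).trans h.le)
  have hLa : (T : ℝ) * L = T * a + T * (L - a) := by ring
  rw [hLa, ofReal_exp_add] at this
  exact (ENNReal.mul_le_mul_iff_right (ofReal_exp_ne_zero _) ENNReal.ofReal_ne_top).1 this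

theorem tendsto_measure_notMem_of_tendstoInMeasure {E : Type*} [PseudoMetricSpace E]
    {Y : ℕ → Ω → E} {y : E}
    (h : TendstoInMeasure μ Y atTop fun _ => y) {U : Set E} (hU : U ∈ 𝓝 y) :
    Tendsto (fun T => μ {ω | Y T ω ∉ U}) atTop (𝓝 0) := by
  obtain ⟨ε, hε, hεU⟩ := Metric.mem_nhds_iff.1 hU
  refine tendsto_of_tendsto_of_tendsto_of_le_of_le tendsto_const_nhds
    (tendstoInMeasure_iff_dist.1 h ε hε) (fun _ => zero_le) fun T => measure_mono fun ω hω => ?_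
  simp only [mem_ofPred_eq] at hω ⊢
  contrapose! hω
  exact hεU hω

theorem half_lt_measure_of_tendsto_compl [IsProbabilityMeasure μ] {A : ℕ → Set Ω}
    (h : Tendsto (fun T => μ (A T)ᶜ) atTop (𝓝 0)) : ∀ᶠ T in atTop, 1 / 2 ≤ μ (A T) := by
  filter_upwards [h.eventually_lt_const (show (0 : ℝ≥0∞) < 1 / 2 by simp)] with T hT
  have h1 : (1 : ℝ≥0∞) ≤ μ (A T) + μ (A T)ᶜ := by
    rw [← measure_univ (μ := μ), ← union_compl_self (A T)]
    exact measure_union_le _ _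
  by_contra! hlt
  have := ENNReal.add_lt_add hlt hT
  rw [ENNReal.add_halves] at this
  exact absurd h1 this.not_ge

/-- The limiting log-moment generating function dominates the linear function given by the limit
in probability of the statistic. -/
theorem inner_le_of_tendstoInMeasure [IsProbabilityMeasure μ]
    (hSm : ∀ T, 1 ≤ T → Measurable (S T)) {l : Euc d} {Λl : EReal} (hΛ : Tendsto
      (fun T : ℕ => ((1 / (T : ℝ) : ℝ) : EReal) * logMGF μ (S T) ((T : ℝ) • l)) atTop (𝓝 Λl))
    {s : Euc d} (hs : TendstoInMeasure μ S atTop fun _ => s) :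
    ((inner ℝ l s : ℝ) : EReal) ≤ Λl := by
  by_contra! hlt
  obtain ⟨L, hL, hLs⟩ := EReal.lt_iff_exists_real_btwn.1 hlt
  rw [EReal.coe_lt_coe_iff] at hLs
  -- With `L < a < ⟨l, s⟩` the half space at level `a` is a neighbourhood of `s`, so it has mass at
  -- least one half eventually, while its Chernoff exponent `L - a` is negative.
  obtain ⟨a, hLa, has⟩ := exists_between hLs
  have hU : {s' : Euc d | a ≤ inner ℝ l s'} ∈ 𝓝 s :=
    (((by fun_prop : Continuous fun s' : Euc d => (inner ℝ l s' : ℝ)).tendsto s).eventually_const_lt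
      has).mono fun _ h => le_of_lt h
  have h1 := half_lt_measure_of_tendsto_compl (A := fun T => {ω | a ≤ inner ℝ l (S T ω)})
    (tendsto_measure_notMem_of_tendstoInMeasure hs hU)
  have h2 := eventually_measure_halfSpace_le hSm hΛ hL a
  have h3 := eventually_const_lt_exp (sub_pos.2 hLa) (C := 2) (by simp)
  obtain ⟨T, h1, h2, h3⟩ := (h1.and (h2.and h3)).exists
  have h4 : (2 : ℝ≥0∞)⁻¹ * 2 < ENNReal.ofReal (Real.exp (T * (L - a))) *
      ENNReal.ofReal (Real.exp (T * (a - L))) :=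
    ((ENNReal.mul_lt_mul_iff_right (by simp) (by simp)).2 h3).trans_le
      (mul_le_mul_left (by simpa using h1.trans h2) _)
  rw [← ofReal_exp_add, show (T : ℝ) * (L - a) + T * (a - L) = 0 by ring,
    ENNReal.inv_mul_cancel (by simp) (by simp)] at h4
  simp at h4

/-- The large deviation upper bound for compact sets. -/
theorem eventually_measure_compact_lt (hSm : ∀ T, 1 ≤ T → Measurable (S T))
    {Λ : Euc d → EReal} (hΛ : ∀ l, Tendsto
      (fun T : ℕ => ((1 / (T : ℝ) : ℝ) : EReal) * logMGF μ (S T) ((T : ℝ) • l)) atTop (𝓝 (Λ l)))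
    {D : Set (Euc d)} (hD : IsCompact D) {r : ℝ}
    (hr : ∀ s ∈ D, (r : EReal) ≤ ⨆ l, ((inner ℝ l s : ℝ) : EReal) - Λ l) {y : ℝ} (hy : -r < y) :
    ∀ᶠ T : ℕ in atTop, μ {ω | S T ω ∈ D} < ENNReal.ofReal (Real.exp (T * y)) := by
  -- The gap between `z` and `y` absorbs the constant `C` that a finite cover by half spaces
  -- produces.
  obtain ⟨z, hrz, hzy⟩ := exists_between hy
  have key : ∃ C : ℝ≥0∞, C ≠ ⊤ ∧
      ∀ᶠ T : ℕ in atTop, μ {ω | S T ω ∈ D} ≤ C * ENNReal.ofReal (Real.exp (T * z)) := by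
    refine hD.induction_on (p := fun D => ∃ C : ℝ≥0∞, C ≠ ⊤ ∧
      ∀ᶠ T : ℕ in atTop, μ {ω | S T ω ∈ D} ≤ C * ENNReal.ofReal (Real.exp (T * z))) ?_ ?_ ?_ ?_
    · exact ⟨0, by simp, by simp⟩
    · rintro s t hst ⟨C, hC, h⟩
      refine ⟨C, hC, h.mono fun T hT => (measure_mono fun ω hω => ?_).trans hT⟩
      exact hst hω
    · rintro s t ⟨C, hC, h⟩ ⟨C', hC', h'⟩
      refine ⟨C + C', by simp [hC, hC'], ?_⟩
      filter_upwards [h, h'] with T hT hT'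
      rw [add_mul]
      exact (measure_union_le _ _).trans (add_le_add hT hT')
    · intro s hs
      have h1 : ((-z : ℝ) : EReal) < ⨆ l, ((inner ℝ l s : ℝ) : EReal) - Λ l :=
        lt_of_lt_of_le (EReal.coe_lt_coe_iff.2 (by linarith)) (hr s hs)
      obtain ⟨l, hl⟩ := lt_iSup_iff.1 h1
      have h2 : Λ l < ((inner ℝ l s + z : ℝ) : EReal) := by
        generalize Λ l = w at hl ⊢
        induction w with
        | bot => exact EReal.bot_lt_coe _
        | top => simp at hl
        | coe w =>
          rw [← EReal.coe_sub, EReal.coe_lt_coe_iff] at hl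
          rw [EReal.coe_lt_coe_iff]
          linarith
      -- For `Λ l < L < ⟨l, s⟩ + z` the half space at level `L - z` contains a neighbourhood of `s`,
      -- and its Chernoff exponent is `L - (L - z) = z`.
      obtain ⟨L, hL, hLs⟩ := EReal.lt_iff_exists_real_btwn.1 h2
      rw [EReal.coe_lt_coe_iff] at hLs
      refine ⟨{s' | L - z ≤ inner ℝ l s'}, mem_nhdsWithin_of_mem_nhds
        ((((by fun_prop : Continuous fun s' : Euc d => (inner ℝ l s' : ℝ)).tendsto
          s).eventually_const_lt (u := L - z) (by linarith)).mono fun _ h => le_of_lt h),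
        1, by simp, ?_⟩
      · filter_upwards [eventually_measure_halfSpace_le hSm (hΛ l) hL (L - z)] with T hT
        rw [sub_sub_cancel] at hT
        rw [one_mul]
        exact hT
  obtain ⟨C, hC, h⟩ := key
  filter_upwards [h, eventually_const_lt_exp (sub_pos.2 hzy) hC] with T h1 h2
  refine h1.trans_lt ?_
  rw [show (T : ℝ) * y = T * (y - z) + T * z by ring, ofReal_exp_add]
  exact (ENNReal.mul_lt_mul_iff_left (ofReal_exp_ne_zero _) ENNReal.ofReal_ne_top).2 h2

end LogMGF

/-- Change of measure between two members of an exponential family. -/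
theorem IsExponentialFamily.exists_changeOfMeasure {Ω : Type*} [MeasurableSpace Ω] {m d : ℕ}
    {Θ : Set (Euc d)} {ξ : ℕ → Ω → Euc m} {hξ : ∀ t, Measurable (ξ t)} {P : Euc d → Measure Ω}
    {S : ℕ → Ω → Euc d} (h : IsExponentialFamily Θ ξ hξ P S)
    (hP : ∀ θ ∈ Θ, IsProbabilityMeasure (P θ))
    (hSm : ∀ T, 1 ≤ T → Measurable[history ξ T] (S T)) {θ₀ θ₁ : Euc d} (h₀ : θ₀ ∈ Θ)
    (h₁ : θ₁ ∈ Θ) :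
    ∃ l : Euc d, ∀ T, 1 ≤ T → ∀ F : Set Ω, MeasurableSet[history ξ T] F →
      P θ₀ F * ∫⁻ ω, ENNReal.ofReal (Real.exp (inner ℝ ((T : ℝ) • l) (S T ω))) ∂(P θ₁) =
        ∫⁻ ω in F, ENNReal.ofReal (Real.exp (inner ℝ ((T : ℝ) • l) (S T ω))) ∂(P θ₁) := by
  obtain ⟨θb, hθb, g, -, hg⟩ := h
  refine ⟨g θ₀ - g θ₁, fun T hT F hF => ?_⟩
  have := hP θb hθb
  have hle := history_le hξ T
  set A : Euc d → ℝ := fun θ => (logMGF (P θb) (S T) ((T : ℝ) • g θ)).toReal with hA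
  have hexpm : ∀ (l : Euc d) (b : ℝ), Measurable[history ξ T]
      fun ω => ENNReal.ofReal (Real.exp (inner ℝ l (S T ω) - b)) := by
    intro l b
    have := hSm T hT
    fun_prop
  have hint : ∀ θ ∈ Θ, ∀ f : Ω → ℝ≥0∞, Measurable[history ξ T] f → ∫⁻ ω, f ω ∂(P θ) =
      ∫⁻ ω, ENNReal.ofReal (Real.exp (inner ℝ ((T : ℝ) • g θ) (S T ω) - A θ)) * f ω ∂(P θb) := by
    intro θ hθ f hf
    rw [← lintegral_trim hle hf, (hg T hT θ hθ).2,
      lintegral_withDensity_eq_lintegral_mul _ (hexpm _ _) hf,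
      lintegral_trim hle ((hexpm _ _).mul hf)]
    rfl
  have hA0 : ENNReal.ofReal (Real.exp (A θ₀)) =
      ∫⁻ ω, ENNReal.ofReal (Real.exp (inner ℝ ((T : ℝ) • g θ₀) (S T ω))) ∂(P θb) := by
    have hne : (∫⁻ ω, ENNReal.ofReal (Real.exp (inner ℝ ((T : ℝ) • g θ₀) (S T ω))) ∂(P θb)) ≠ 0 := by
      have hm : Measurable fun ω =>
          ENNReal.ofReal (Real.exp (inner ℝ ((T : ℝ) • g θ₀) (S T ω))) := by
        have := (hSm T hT).mono hle le_rfl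
        fun_prop
      intro h0
      rw [lintegral_eq_zero_iff hm] at h0
      have : ∀ᵐ ω ∂(P θb), False := h0.mono fun ω hω => ofReal_exp_ne_zero _ hω
      exact this.exists.elim fun _ h => h
    have hlt := (hg T hT θ₀ h₀).1
    rw [logMGF, ENNReal.log_lt_top_iff] at hlt
    obtain ⟨u, hu, hu'⟩ := log_eq_coe_of_ne hne hlt.ne
    rw [hu, hA]
    simp only [logMGF]
    rw [hu', EReal.toReal_coe]
  have hadd : ∀ ω, ENNReal.ofReal (Real.exp (inner ℝ ((T : ℝ) • g θ₁) (S T ω) - A θ₁)) *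
      ENNReal.ofReal (Real.exp (inner ℝ ((T : ℝ) • (g θ₀ - g θ₁)) (S T ω) - 0)) =
      ENNReal.ofReal (Real.exp (A θ₀ - A θ₁)) *
        ENNReal.ofReal (Real.exp (inner ℝ ((T : ℝ) • g θ₀) (S T ω) - A θ₀)) := by
    intro ω
    rw [← ofReal_exp_add, ← ofReal_exp_add]
    congr 2
    rw [smul_sub, inner_sub_left]
    ring
  have hl := hexpm ((T : ℝ) • (g θ₀ - g θ₁)) 0
  simp only [sub_zero] at hl hadd
  have hsub : ∀ G : Set Ω, MeasurableSet[history ξ T] G →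
      ∫⁻ ω in G, ENNReal.ofReal (Real.exp (inner ℝ ((T : ℝ) • (g θ₀ - g θ₁)) (S T ω))) ∂(P θ₁) =
        ENNReal.ofReal (Real.exp (A θ₀ - A θ₁)) * P θ₀ G := by
    intro G hG
    have hone : Measurable[history ξ T] (G.indicator (1 : Ω → ℝ≥0∞)) :=
      Measurable.indicator (@measurable_const _ _ _ (history ξ T) 1) hG
    rw [← lintegral_indicator (hle _ hG), hint θ₁ h₁ _ (hl.indicator hG), ← lintegral_indicator_one
      (hle _ hG), hint θ₀ h₀ _ hone, ← lintegral_const_mul']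
    · refine lintegral_congr fun ω => ?_
      by_cases hω : ω ∈ G
      · simp only [indicator_of_mem hω, Pi.one_apply, mul_one]
        exact hadd ω
      · simp [indicator_of_notMem hω]
    · exact ENNReal.ofReal_ne_top
  -- The whole space identifies the constant `exp (A θ₀ - A θ₁)` with the moment generating function
  -- under `θ₁`.
  have huniv := hsub univ MeasurableSet.univ
  have := hP θ₀ h₀
  rw [Measure.restrict_univ, measure_univ, mul_one] at huniv
  rw [huniv, hsub F hF, mul_comm]

end DataDriven

/-! ### The extended cost. -/

namespace DataDriven

/-- Uniform continuity makes the image of `𝓝[A] p` a Cauchy filter, which converges by completeness.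
-/
theorem tendsto_extendFrom_of_uniformContinuousOn {α β : Type*} [UniformSpace α] [UniformSpace β]
    [CompleteSpace β] {f : α → β} {A : Set α} (hf : UniformContinuousOn f A) {p : α}
    (hp : p ∈ closure A) : Tendsto f (𝓝[A] p) (𝓝 (extendFrom A f p)) := by
  have : (𝓝[A] p).NeBot := mem_closure_iff_nhdsWithin_neBot.1 hp
  refine tendsto_extendFrom (CompleteSpace.complete (f := map f (𝓝[A] p)) ⟨inferInstance, ?_⟩)
  rw [Filter.prod_map_map_eq]
  refine Tendsto.mono_left hf (le_inf ((Filter.prod_mono inf_le_left inf_le_left).trans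
    (cauchy_nhds (a := p)).2) ?_)
  rw [← prod_principal_principal]
  exact Filter.prod_mono inf_le_right inf_le_right

/-- Covers both uses: the function changes with the decision `x`, the index set with the statistic
`s`. -/
theorem abs_sSup_image_sub_sSup_image_le {α : Type*} {f g : α → ℝ} {A B : Set α}
    (hA : A.Nonempty) (hB : B.Nonempty) (hfA : BddAbove (f '' A)) (hgB : BddAbove (g '' B)) {ε : ℝ}
    (h : ∀ a ∈ A, ∃ b ∈ B, |f a - g b| ≤ ε) (h' : ∀ b ∈ B, ∃ a ∈ A, |f a - g b| ≤ ε) :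
    |sSup (f '' A) - sSup (g '' B)| ≤ ε := by
  rw [abs_sub_le_iff, sub_le_iff_le_add, sub_le_iff_le_add]
  constructor
  · refine csSup_le (hA.image f) ?_
    rintro _ ⟨a, ha, rfl⟩
    obtain ⟨b, hb, hab⟩ := h a ha
    linarith [le_csSup hgB (mem_image_of_mem g hb), (abs_le.1 hab).2]
  · refine csSup_le (hB.image g) ?_
    rintro _ ⟨b, hb, rfl⟩
    obtain ⟨a, ha, hab⟩ := h' b hb
    linarith [le_csSup hfA (mem_image_of_mem f ha), (abs_le.1 hab).1]

theorem abs_iInf_sub_iInf_le {ι : Type*} {f g : ι → ℝ} (hf : BddBelow (range f))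
    (hg : BddBelow (range g)) {ε : ℝ} (hε : 0 ≤ ε) (h : ∀ i, |f i - g i| ≤ ε) :
    |(⨅ i, f i) - ⨅ i, g i| ≤ ε := by
  -- Over an empty index type both infima are `0`.
  cases isEmpty_or_nonempty ι
  · simpa using hε
  rw [abs_sub_le_iff, sub_le_iff_le_add', sub_le_iff_le_add']
  constructor
  · rw [← sub_le_iff_le_add]
    exact le_ciInf fun i => by linarith [ciInf_le hf i, (abs_le.1 (h i)).2]
  · rw [← sub_le_iff_le_add]
    exact le_ciInf fun i => by linarith [ciInf_le hg i, (abs_le.1 (h i)).1]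

section Cost

variable {n d : ℕ} {X : Set (Euc n)} {Θ : Set (Euc d)} {c : Euc n → Euc d → ℝ}

theorem mem_closure_prod {x : Euc n} {θ : Euc d} (hx : x ∈ X) (hθ : θ ∈ closure Θ) :
    (x, θ) ∈ closure (X ×ˢ Θ) := by
  rw [closure_prod_eq]
  exact ⟨subset_closure hx, hθ⟩

namespace IsModelPredictor

theorem tendsto_extendedCost (hc : IsModelPredictor X Θ c) {x : Euc n} {θ : Euc d} (hx : x ∈ X)
    (hθ : θ ∈ closure Θ) : Tendsto (fun p : Euc n × Euc d => c p.1 p.2) (𝓝[X ×ˢ Θ] (x, θ))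
      (𝓝 (extendedCost X Θ c x θ)) :=
  tendsto_extendFrom_of_uniformContinuousOn hc.uniformContinuousOn (mem_closure_prod hx hθ)

theorem extendedCost_eq (hc : IsModelPredictor X Θ c) {x : Euc n} {θ : Euc d} (hx : x ∈ X)
    (hθ : θ ∈ Θ) : extendedCost X Θ c x θ = c x θ :=
  extendFrom_extends hc.uniformContinuousOn.continuousOn (x, θ) ⟨hx, hθ⟩

theorem exists_abs_extendedCost_le (hc : IsModelPredictor X Θ c) :
    ∃ M : ℝ, 0 ≤ M ∧ ∀ x ∈ X, ∀ θ ∈ closure Θ, |extendedCost X Θ c x θ| ≤ M := by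
  obtain ⟨M, hM⟩ := hc.bounded
  refine ⟨|M|, abs_nonneg M, fun x hx θ hθ => ?_⟩
  have : (𝓝[X ×ˢ Θ] (x, θ)).NeBot := mem_closure_iff_nhdsWithin_neBot.1 (mem_closure_prod hx hθ)
  refine le_of_tendsto (hc.tendsto_extendedCost hx hθ).abs ?_
  filter_upwards [self_mem_nhdsWithin] with p hp
  exact (hM _ hp.1 _ hp.2).trans (le_abs_self M)

/-- The modulus of continuity of `c` survives the passage to the limit in both points at once, along
the product of the two neighbourhood filters. -/
theorem exists_abs_extendedCost_sub_le (hc : IsModelPredictor X Θ c) {ε : ℝ} (hε : 0 < ε) :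
    ∃ δ > 0, ∀ x ∈ X, ∀ x' ∈ X, ∀ θ ∈ closure Θ, ∀ θ' ∈ closure Θ, dist x x' < δ → dist θ θ' < δ →
      |extendedCost X Θ c x θ - extendedCost X Θ c x' θ'| ≤ ε := by
  obtain ⟨δ, hδ, h⟩ := Metric.uniformContinuousOn_iff.1 hc.uniformContinuousOn ε hε
  refine ⟨δ, hδ, fun x hx x' hx' θ hθ θ' hθ' hxx hθθ => ?_⟩
  have : (𝓝[X ×ˢ Θ] (x, θ)).NeBot := mem_closure_iff_nhdsWithin_neBot.1 (mem_closure_prod hx hθ)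
  have : (𝓝[X ×ˢ Θ] (x', θ')).NeBot :=
    mem_closure_iff_nhdsWithin_neBot.1 (mem_closure_prod hx' hθ')
  have hlim := (((hc.tendsto_extendedCost hx hθ).comp tendsto_fst).sub
    ((hc.tendsto_extendedCost hx' hθ').comp
      (tendsto_snd (f := 𝓝[X ×ˢ Θ] (x, θ))))).abs
  refine le_of_tendsto hlim ?_
  have hd : ∀ᶠ q : (Euc n × Euc d) × (Euc n × Euc d) in
      𝓝[X ×ˢ Θ] (x, θ) ×ˢ 𝓝[X ×ˢ Θ] (x', θ'), dist q.1 q.2 < δ := by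
    have : Tendsto (fun q : (Euc n × Euc d) × (Euc n × Euc d) => dist q.1 q.2)
        (𝓝[X ×ˢ Θ] (x, θ) ×ˢ 𝓝[X ×ˢ Θ] (x', θ')) (𝓝 (dist (x, θ) (x', θ'))) :=
      ((tendsto_fst.mono_right nhdsWithin_le_nhds).dist (tendsto_snd.mono_right nhdsWithin_le_nhds))
    exact this.eventually_lt_const (by rw [Prod.dist_eq]; exact max_lt hxx hθθ)
  filter_upwards [hd, prod_mem_prod (self_mem_nhdsWithin (a := (x, θ)))
    (self_mem_nhdsWithin (a := (x', θ')))] with q hq hm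
  exact (h _ hm.1 _ hm.2 hq).le

end IsModelPredictor

/-! ### Bounds, continuity in the decision and measurability of the robust predictor. -/

section Robust

variable {𝕊 : Set (Euc d)} {I : Euc d → Euc d → ℝ≥0∞} {r : ℝ}

open Classical in
/-- The set of models over which the robust predictor takes the worst case. -/
noncomputable def ambiguity (𝕊 Θ : Set (Euc d)) (I : Euc d → Euc d → ℝ≥0∞) (r : ℝ) (s : Euc d) :
    Set (Euc d) :=
  if ∃ θ, (s, θ) ∈ sublevel 𝕊 Θ I r then {θ | (s, θ) ∈ sublevel 𝕊 Θ I r} else closure Θ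

theorem robustPredictor_eq (x : Euc n) (s : Euc d) :
    robustPredictor X 𝕊 Θ c I r x s =
      sSup (extendedCost X Θ c x '' ambiguity 𝕊 Θ I r s) := by
  unfold robustPredictor ambiguity
  split_ifs <;> rfl

theorem ambiguity_of_mem {s θ : Euc d} (h : (s, θ) ∈ sublevel 𝕊 Θ I r) :
    ambiguity 𝕊 Θ I r s = {θ | (s, θ) ∈ sublevel 𝕊 Θ I r} :=
  if_pos ⟨θ, h⟩

theorem ambiguity_of_notMem_image {s : Euc d} (h : s ∉ Prod.fst '' sublevel 𝕊 Θ I r) :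
    ambiguity 𝕊 Θ I r s = closure Θ :=
  if_neg fun ⟨θ, hθ⟩ => h ⟨(s, θ), hθ, rfl⟩

theorem ambiguity_subset (s : Euc d) : ambiguity 𝕊 Θ I r s ⊆ closure Θ := by
  unfold ambiguity
  split_ifs
  · exact fun θ hθ => hθ.1.2
  · exact Subset.rfl

theorem ambiguity_nonempty (hΘ : Θ.Nonempty) (s : Euc d) : (ambiguity 𝕊 Θ I r s).Nonempty := by
  unfold ambiguity
  split_ifs with h
  · exact h
  · exact hΘ.closure

theorem bddAbove_image_ambiguity (hc : IsModelPredictor X Θ c) {x : Euc n} (hx : x ∈ X)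
    (s : Euc d) : BddAbove (extendedCost X Θ c x '' ambiguity 𝕊 Θ I r s) := by
  obtain ⟨M, -, hM⟩ := hc.exists_abs_extendedCost_le
  refine ⟨M, ?_⟩
  rintro _ ⟨θ, hθ, rfl⟩
  exact (abs_le.1 (hM x hx θ (ambiguity_subset s hθ))).2

theorem extendedCost_le_robustPredictor (hc : IsModelPredictor X Θ c) {x : Euc n} (hx : x ∈ X)
    {s θ : Euc d} (hθ : θ ∈ ambiguity 𝕊 Θ I r s) :
    extendedCost X Θ c x θ ≤ robustPredictor X 𝕊 Θ c I r x s := by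
  rw [robustPredictor_eq]
  exact le_csSup (bddAbove_image_ambiguity hc hx s) (mem_image_of_mem _ hθ)

theorem exists_abs_robustPredictor_le (hc : IsModelPredictor X Θ c) (hΘ : Θ.Nonempty) :
    ∃ M : ℝ, 0 ≤ M ∧ ∀ x ∈ X, ∀ s, |robustPredictor X 𝕊 Θ c I r x s| ≤ M := by
  obtain ⟨M, hM0, hM⟩ := hc.exists_abs_extendedCost_le
  refine ⟨M, hM0, fun x hx s => ?_⟩
  obtain ⟨θ, hθ⟩ := ambiguity_nonempty (𝕊 := 𝕊) (I := I) (r := r) hΘ s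
  rw [abs_le]
  constructor
  · exact (abs_le.1 (hM x hx θ (ambiguity_subset s hθ))).1.trans
      (extendedCost_le_robustPredictor hc hx hθ)
  · rw [robustPredictor_eq]
    refine csSup_le ⟨_, mem_image_of_mem _ hθ⟩ ?_
    rintro _ ⟨θ, hθ, rfl⟩
    exact (abs_le.1 (hM x hx θ (ambiguity_subset s hθ))).2

/-- The ambiguity set does not depend on the decision, so `δ` can be chosen uniformly in `s`. -/
theorem exists_abs_robustPredictor_sub_le (hc : IsModelPredictor X Θ c) (hΘ : Θ.Nonempty)
    {ε : ℝ} (hε : 0 < ε) : ∃ δ > 0, ∀ x ∈ X, ∀ x' ∈ X, dist x x' < δ → ∀ s,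
      |robustPredictor X 𝕊 Θ c I r x s - robustPredictor X 𝕊 Θ c I r x' s| ≤ ε := by
  obtain ⟨δ, hδ, h⟩ := hc.exists_abs_extendedCost_sub_le hε
  refine ⟨δ, hδ, fun x hx x' hx' hxx s => ?_⟩
  rw [robustPredictor_eq, robustPredictor_eq]
  have key : ∀ θ ∈ ambiguity 𝕊 Θ I r s, |extendedCost X Θ c x θ - extendedCost X Θ c x' θ| ≤ ε :=
    fun θ hθ => h x hx x' hx' θ (ambiguity_subset s hθ) θ (ambiguity_subset s hθ) hxx (by simpa)
  exact abs_sSup_image_sub_sSup_image_le (ambiguity_nonempty hΘ s) (ambiguity_nonempty hΘ s)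
    (bddAbove_image_ambiguity hc hx s) (bddAbove_image_ambiguity hc hx' s)
    (fun θ hθ => ⟨θ, hθ, key θ hθ⟩) (fun θ hθ => ⟨θ, hθ, key θ hθ⟩)

theorem continuousOn_robustPredictor (hc : IsModelPredictor X Θ c) (hΘ : Θ.Nonempty) (s : Euc d) :
    ContinuousOn (fun x => robustPredictor X 𝕊 Θ c I r x s) X := by
  rw [Metric.continuousOn_iff]
  intro x hx ε hε
  obtain ⟨δ, hδ, h⟩ := exists_abs_robustPredictor_sub_le (𝕊 := 𝕊) (I := I) (r := r) hc hΘ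
    (half_pos hε)
  exact ⟨δ, hδ, fun x' hx' hd => (h x' hx' x hx hd s).trans_lt (half_lt_self hε)⟩

theorem continuousOn_extendedCost (hc : IsModelPredictor X Θ c) {x : Euc n} (hx : x ∈ X) :
    ContinuousOn (extendedCost X Θ c x) (closure Θ) := by
  rw [Metric.continuousOn_iff]
  intro θ hθ ε hε
  obtain ⟨δ, hδ, h⟩ := hc.exists_abs_extendedCost_sub_le (half_pos hε)
  exact ⟨δ, hδ, fun θ' hθ' hd =>
    (h x hx x hx θ' hθ' θ hθ (by simpa) hd).trans_lt (half_lt_self hε)⟩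

theorem isCompact_slice (h : IsCompact (sublevel 𝕊 Θ I r)) (s : Euc d) :
    IsCompact {θ | (s, θ) ∈ sublevel 𝕊 Θ I r} := by
  have h1 : IsCompact (sublevel 𝕊 Θ I r ∩ Prod.fst ⁻¹' {s}) :=
    h.inter_right (isClosed_singleton.preimage continuous_fst)
  convert h1.image continuous_snd using 1
  ext θ
  constructor
  · exact fun hθ => ⟨(s, θ), ⟨hθ, rfl⟩, rfl⟩
  · rintro ⟨⟨s', θ'⟩, ⟨h, rfl⟩, rfl⟩
    exact h

/-- Where the slice is nonempty the supremum is attained, so a superlevel set is there the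
projection of a compact set; elsewhere the predictor is constant in `s`. -/
theorem measurable_robustPredictor (hc : IsModelPredictor X Θ c)
    (hcpt : IsCompact (sublevel 𝕊 Θ I r)) {x : Euc n} (hx : x ∈ X) :
    Measurable (robustPredictor X 𝕊 Θ c I r x) := by
  refine measurable_of_Ici fun a => ?_
  have hcont := continuousOn_extendedCost hc hx
  have h1 : IsClosed (sublevel 𝕊 Θ I r ∩
      (fun p : Euc d × Euc d => extendedCost X Θ c x p.2) ⁻¹' Ici a) :=
    ContinuousOn.preimage_isClosed_of_isClosed
      (hcont.comp continuous_snd.continuousOn fun p hp => hp.1.2) hcpt.isClosed isClosed_Ici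
  have h2 := ((hcpt.of_isClosed_subset h1 inter_subset_left).image continuous_fst).measurableSet
  have h3 := (hcpt.image continuous_fst).measurableSet
  have heq : robustPredictor X 𝕊 Θ c I r x ⁻¹' Ici a =
      Prod.fst '' (sublevel 𝕊 Θ I r ∩
        (fun p : Euc d × Euc d => extendedCost X Θ c x p.2) ⁻¹' Ici a) ∪
      ((Prod.fst '' sublevel 𝕊 Θ I r)ᶜ ∩
        {_s | a ≤ sSup (extendedCost X Θ c x '' closure Θ)}) := by
    ext s
    by_cases hs : s ∈ Prod.fst '' sublevel 𝕊 Θ I r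
    · simp only [mem_union, mem_inter_iff, mem_compl_iff, hs, not_true, false_and, or_false,
        mem_preimage, mem_Ici]
      obtain ⟨⟨s, θ⟩, hθ, rfl⟩ := hs
      constructor
      · intro h
        rw [robustPredictor_eq, ambiguity_of_mem hθ] at h
        obtain ⟨θ', hθ', hmax⟩ := (isCompact_slice hcpt s).exists_sSup_image_eq ⟨θ, hθ⟩
          (hcont.mono fun θ hθ => hθ.1.2)
        rw [hmax] at h
        exact ⟨(s, θ'), ⟨hθ', h⟩, rfl⟩
      · rintro ⟨⟨s', θ'⟩, ⟨h, h'⟩, rfl⟩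
        refine le_trans h' (extendedCost_le_robustPredictor hc hx ?_)
        rw [ambiguity_of_mem h]
        exact h
    · have hs' : s ∉ Prod.fst '' (sublevel 𝕊 Θ I r ∩
        (fun p : Euc d × Euc d => extendedCost X Θ c x p.2) ⁻¹' Ici a) :=
        fun h => hs (image_mono inter_subset_left h)
      simp only [mem_union, mem_inter_iff, mem_compl_iff, hs, hs', not_false_eq_true, true_and,
        false_or, mem_preimage, mem_Ici, mem_ofPred_eq]
      rw [robustPredictor_eq, ambiguity_of_notMem_image hs]
  rw [heq]
  exact h2.union (h3.compl.inter (MeasurableSet.const _))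

/-! ### Continuity in the statistic at its asymptotic realizations. -/

section Limit

variable {Sinf : Euc d → Euc d}

theorem IsRegularRateFunction.tendsto_left (hreg : IsRegularRateFunction 𝕊 Θ Sinf I) {s θ : Euc d}
    (hs : s ∈ 𝕊) (hθ : θ ∈ Θ) : Tendsto (fun s => I s θ) (𝓝[𝕊] s) (𝓝 (I s θ)) := by
  have h := hreg.continuousOn (s, θ) ⟨hs, hθ⟩
  exact ContinuousWithinAt.comp (t := 𝕊 ×ˢ Θ) (f := fun s => (s, θ)) h
    (by fun_prop : Continuous fun s : Euc d => (s, θ)).continuousWithinAt fun s' hs' => ⟨hs', hθ⟩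

theorem IsRegularRateFunction.eventually_mem_sublevel (hreg : IsRegularRateFunction 𝕊 Θ Sinf I)
    {s θ : Euc d} (hs : s ∈ 𝕊) (hθ : θ ∈ Θ) (hI : I s θ < ENNReal.ofReal r) :
    ∀ᶠ s' in 𝓝[𝕊] s, (s', θ) ∈ sublevel 𝕊 Θ I r := by
  filter_upwards [(hreg.tendsto_left hs hθ).eventually_lt_const hI, self_mem_nhdsWithin]
    with s' h hs'
  exact ⟨⟨hs', subset_closure hθ⟩, h.le⟩

/-- Upper hemicontinuity of the slices: the pairs at distance at least `δ` from the slice at `s`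
form a compact set, whose projection is closed and misses `s`. -/
theorem eventually_forall_exists_dist_lt (hcpt : IsCompact (sublevel 𝕊 Θ I r)) {s : Euc d}
    (hne : {θ | (s, θ) ∈ sublevel 𝕊 Θ I r}.Nonempty) {δ : ℝ} (hδ : 0 < δ) :
    ∀ᶠ s' in 𝓝 s, ∀ θ, (s', θ) ∈ sublevel 𝕊 Θ I r →
      ∃ θ', (s, θ') ∈ sublevel 𝕊 Θ I r ∧ dist θ θ' < δ := by
  have h1 : IsCompact (sublevel 𝕊 Θ I r ∩ {p : Euc d × Euc d |
      δ ≤ Metric.infDist p.2 {θ | (s, θ) ∈ sublevel 𝕊 Θ I r}}) :=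
    hcpt.inter_right (isClosed_le continuous_const
      ((Metric.continuous_infDist_pt _).comp continuous_snd))
  have h2 := (h1.image continuous_fst).isClosed
  have h3 : s ∉ Prod.fst '' (sublevel 𝕊 Θ I r ∩ {p : Euc d × Euc d |
      δ ≤ Metric.infDist p.2 {θ | (s, θ) ∈ sublevel 𝕊 Θ I r}}) := by
    rintro ⟨⟨s, θ⟩, ⟨h, h'⟩, rfl⟩
    have h' : δ ≤ Metric.infDist θ {θ | (s, θ) ∈ sublevel 𝕊 Θ I r} := h'
    rw [Metric.infDist_zero_of_mem (s := {θ | (s, θ) ∈ sublevel 𝕊 Θ I r}) h] at h'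
    exact hδ.not_ge h'
  filter_upwards [h2.isOpen_compl.mem_nhds h3] with s' hs' θ hθ
  by_contra! hcon
  refine hs' ⟨(s', θ), ⟨hθ, ?_⟩, rfl⟩
  exact (Metric.le_infDist hne).2 fun {θ'} hθ' => hcon θ' hθ'

/-- Lower hemicontinuity of the slices. Radial monotonicity approximates each `θ` by some `θ' ∈ Θ`
with rate strictly below `r`, and the strict inequality persists for nearby `s'`. Compactness of the
slice makes the neighbourhood uniform in `θ`. -/
theorem IsRegularRateFunction.eventually_forall_exists_dist_lt
    (hreg : IsRegularRateFunction 𝕊 Θ Sinf I) (hr : 0 < r) {s : Euc d} (hs : s ∈ 𝕊)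
    (hs' : s ∈ Sinf '' Θ) {δ : ℝ} (hδ : 0 < δ) :
    ∀ᶠ s' in 𝓝[𝕊] s, ∀ θ, (s, θ) ∈ sublevel 𝕊 Θ I r →
      ∃ θ', (s', θ') ∈ sublevel 𝕊 Θ I r ∧ dist θ' θ < δ := by
  refine (isCompact_slice (hreg.levelCompact r hr.le) s).induction_on
    (p := fun B => ∀ᶠ s' in 𝓝[𝕊] s, ∀ θ ∈ B, ∃ θ', (s', θ') ∈ sublevel 𝕊 Θ I r ∧ dist θ' θ < δ)
    ?_ ?_ ?_ ?_
  · simp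
  · exact fun B C hBC h => h.mono fun s' h θ hθ => h θ (hBC hθ)
  · intro B C hB hC
    filter_upwards [hB, hC] with s' hB hC θ hθ
    exact hθ.elim (hB θ) (hC θ)
  · intro θ hθ
    have hcl : θ ∈ closure {θ | θ ∈ Θ ∧ I s θ < ENNReal.ofReal r} := by
      rw [hreg.radiallyMonotone s hs' r hr]
      exact ⟨hθ.1.2, hθ.2⟩
    obtain ⟨θ', ⟨hθ', hI⟩, hd⟩ := Metric.mem_closure_iff.1 hcl (δ / 2) (half_pos hδ)
    refine ⟨Metric.ball θ (δ / 2), mem_nhdsWithin_of_mem_nhds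
      (Metric.ball_mem_nhds θ (half_pos hδ)), ?_⟩
    filter_upwards [hreg.eventually_mem_sublevel hs hθ' hI] with s' h θ'' hθ''
    refine ⟨θ', h, ?_⟩
    have h1 := Metric.mem_ball'.1 hθ''
    rw [dist_comm] at hd
    linarith [dist_triangle θ' θ θ'']

/-- The robust predictor is continuous at the asymptotic realizations of the statistic, uniformly
in the decisions. -/
theorem eventually_abs_robustPredictor_sub_le (hc : IsModelPredictor X Θ c)
    (hreg : IsRegularRateFunction 𝕊 Θ Sinf I) (hr : 0 < r) {s θ : Euc d} (hs : s ∈ 𝕊)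
    (hs' : s ∈ Sinf '' Θ) (hθ : θ ∈ Θ) (hI : I s θ < ENNReal.ofReal r) {ε : ℝ} (hε : 0 < ε) :
    ∀ᶠ s' in 𝓝[𝕊] s, ∀ x ∈ X,
      |robustPredictor X 𝕊 Θ c I r x s' - robustPredictor X 𝕊 Θ c I r x s| ≤ ε := by
  obtain ⟨δ, hδ, h⟩ := hc.exists_abs_extendedCost_sub_le hε
  have hmem := hreg.eventually_mem_sublevel hs hθ hI
  have hsθ := hmem.self_of_nhdsWithin hs
  filter_upwards [hmem, hreg.eventually_forall_exists_dist_lt hr hs hs' hδ, nhdsWithin_le_nhds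
    (DataDriven.eventually_forall_exists_dist_lt (hreg.levelCompact r hr.le) ⟨θ, hsθ⟩ hδ)]
    with s' h1 h2 h3 x hx
  have hb := bddAbove_image_ambiguity (𝕊 := 𝕊) (I := I) (r := r) hc hx
  have hb' := hb s'
  have hb := hb s
  rw [robustPredictor_eq, robustPredictor_eq, ambiguity_of_mem hsθ, ambiguity_of_mem h1]
  rw [ambiguity_of_mem hsθ] at hb
  rw [ambiguity_of_mem h1] at hb'
  refine abs_sSup_image_sub_sSup_image_le ⟨θ, h1⟩ ⟨θ, hsθ⟩ hb' hb ?_ ?_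
  · intro θ' hθ'
    obtain ⟨θ'', hθ'', hd⟩ := h3 θ' hθ'
    exact ⟨θ'', hθ'', h x hx x hx θ' hθ'.1.2 θ'' hθ''.1.2 (by simpa) hd⟩
  · intro θ' hθ'
    obtain ⟨θ'', hθ'', hd⟩ := h2 θ' hθ'
    exact ⟨θ'', hθ'', h x hx x hx θ'' hθ''.1.2 θ' hθ'.1.2 (by simpa) hd⟩

/-- The optimal value of the robust predictor is continuous at the asymptotic realizations of the
statistic. -/
theorem continuousWithinAt_iInf_robustPredictor (hc : IsModelPredictor X Θ c)
    (hreg : IsRegularRateFunction 𝕊 Θ Sinf I) (hr : 0 < r) {s θ : Euc d} (hs : s ∈ 𝕊)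
    (hs' : s ∈ Sinf '' Θ) (hθ : θ ∈ Θ) (hI : I s θ < ENNReal.ofReal r) :
    ContinuousWithinAt (fun s => ⨅ x : X, robustPredictor X 𝕊 Θ c I r x s) 𝕊 s := by
  obtain ⟨M, -, hM⟩ := exists_abs_robustPredictor_le (𝕊 := 𝕊) (I := I) (r := r) hc ⟨θ, hθ⟩
  have hb : ∀ s, BddBelow (range fun x : X => robustPredictor X 𝕊 Θ c I r x s) := by
    refine fun s => ⟨-M, ?_⟩
    rintro _ ⟨x, rfl⟩
    exact (abs_le.1 (hM x x.2 s)).1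
  refine Metric.tendsto_nhds.2 fun ε hε => ?_
  filter_upwards [eventually_abs_robustPredictor_sub_le hc hreg hr hs hs' hθ hI (half_pos hε)]
    with s' h
  exact (abs_iInf_sub_iInf_le (hb s') (hb s) (half_pos hε).le fun x => h x x.2).trans_lt
    (half_lt_self hε)

/-- The robust predictor is jointly continuous at the asymptotic realizations of the statistic. -/
theorem continuousWithinAt_robustPredictor (hc : IsModelPredictor X Θ c)
    (hreg : IsRegularRateFunction 𝕊 Θ Sinf I) (hr : 0 < r) {x : Euc n} (hx : x ∈ X) {s θ : Euc d}
    (hs : s ∈ 𝕊) (hs' : s ∈ Sinf '' Θ) (hθ : θ ∈ Θ) (hI : I s θ < ENNReal.ofReal r) :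
    ContinuousWithinAt (fun p : Euc n × Euc d => robustPredictor X 𝕊 Θ c I r p.1 p.2) (X ×ˢ 𝕊)
      (x, s) := by
  refine Metric.tendsto_nhds.2 fun ε hε => ?_
  obtain ⟨δ, hδ, h⟩ := exists_abs_robustPredictor_sub_le (𝕊 := 𝕊) (I := I) (r := r) hc ⟨θ, hθ⟩
    (show 0 < ε / 3 by positivity)
  rw [nhdsWithin_prod_eq]
  filter_upwards [prod_mem_prod (inter_mem self_mem_nhdsWithin (mem_nhdsWithin_of_mem_nhds
    (Metric.ball_mem_nhds x hδ))) (eventually_abs_robustPredictor_sub_le hc hreg hr hs hs' hθ hI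
      (show 0 < ε / 3 by positivity))] with p hp
  have h1 := h p.1 hp.1.1 x hx hp.1.2 p.2
  have h2 := hp.2 x hx
  rw [← Real.dist_eq] at h1 h2
  linarith [dist_triangle (robustPredictor X 𝕊 Θ c I r p.1 p.2)
    (robustPredictor X 𝕊 Θ c I r x p.2) (robustPredictor X 𝕊 Θ c I r x s)]

end Limit

end Robust

end Cost

end DataDriven

namespace DataDriven

/-! ### Convergence in probability and of expectations. -/

section Convergence

variable {Ω : Type*} [MeasurableSpace Ω] {μ : Measure Ω}

theorem tendstoInMeasure_comp_of_continuousWithinAt {E F : Type*} [PseudoMetricSpace E]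
    [PseudoMetricSpace F] {Y : ℕ → Ω → E} {y : E} (h : TendstoInMeasure μ Y atTop fun _ => y)
    {A : Set E} (hA : ∀ T, 1 ≤ T → ∀ᵐ ω ∂μ, Y T ω ∈ A) {f : E → F}
    (hf : ContinuousWithinAt f A y) :
    TendstoInMeasure μ (fun T ω => f (Y T ω)) atTop fun _ => f y := by
  refine tendstoInMeasure_iff_dist.2 fun ε hε => ?_
  have hU := mem_nhdsWithin_iff_exists_mem_nhds_inter.1 (Metric.tendsto_nhds.1 hf ε hε)
  obtain ⟨U, hU, hUA⟩ := hU
  refine tendsto_of_tendsto_of_tendsto_of_le_of_le' tendsto_const_nhds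
    (tendsto_measure_notMem_of_tendstoInMeasure h hU) (Eventually.of_forall fun _ => zero_le) ?_
  filter_upwards [eventually_ge_atTop 1] with T hT
  refine measure_mono_ae ?_
  filter_upwards [hA T hT] with ω hω h1 h2
  exact (hUA ⟨h2, hω⟩ : dist (f (Y T ω)) (f y) < ε).not_ge h1

theorem tendsto_integral_of_tendstoInMeasure_const [IsProbabilityMeasure μ] {f : ℕ → Ω → ℝ}
    {a : ℝ} (h : TendstoInMeasure μ f atTop fun _ => a)
    (hf : ∀ T, 1 ≤ T → AEStronglyMeasurable (f T) μ) {bound : Ω → ℝ} (hb : Integrable bound μ)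
    (hfb : ∀ T, 1 ≤ T → ∀ᵐ ω ∂μ, |f T ω| ≤ bound ω) :
    Tendsto (fun T => ∫ ω, f T ω ∂μ) atTop (𝓝 a) := by
  -- Nothing is assumed at `T = 0`, so the sequence is shifted; an almost surely convergent
  -- subsequence of every subsequence then allows dominated convergence.
  rw [← tendsto_add_atTop_iff_nat 1]
  refine tendsto_of_subseq_tendsto fun ns hns => ?_
  obtain ⟨ms, hms, hae⟩ := (h.comp ((tendsto_add_atTop_nat 1).comp hns)).exists_seq_tendsto_ae
  refine ⟨ms, ?_⟩
  have : Tendsto (fun k => ∫ ω, f (ns (ms k) + 1) ω ∂μ) atTop (𝓝 (∫ _, a ∂μ)) :=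
    tendsto_integral_of_dominated_convergence bound (fun k => hf _ (by omega)) hb
      (fun k => hfb _ (by omega)) hae
  simpa using this

end Convergence

/-! ### The robust predictor is data-driven and feasible. -/

variable {Ω : Type*} [MeasurableSpace Ω] {n m d : ℕ} {X : Set (Euc n)} {ξ : ℕ → Ω → Euc m}
  {Θ : Set (Euc d)} {P : Euc d → Measure Ω} {c : Euc n → Euc d → ℝ} {S : ℕ → Ω → Euc d}
  {𝕊 : Set (Euc d)} {Sinf : Euc d → Euc d} {Λ : Euc d → Euc d → EReal}
  {I : Euc d → Euc d → ℝ≥0∞} {r : ℝ}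

theorem IsStatistic.mapsTo (hS : IsStatistic Θ ξ P S 𝕊 Sinf) : MapsTo Sinf Θ 𝕊 :=
  hS.localHomeomorph.1

theorem IsStatistic.ae_mem (hS : IsStatistic Θ ξ P S 𝕊 Sinf) {θ : Euc d} (hθ : θ ∈ Θ) (T : ℕ)
    (hT : 1 ≤ T) : ∀ᵐ ω ∂(P θ), S T ω ∈ 𝕊 :=
  hS.stateSpace.1.2 θ hθ T hT

theorem IsStatistic.continuousOn (hS : IsStatistic Θ ξ P S 𝕊 Sinf) : ContinuousOn Sinf Θ := by
  obtain ⟨h, hloc⟩ := hS.localHomeomorph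
  exact continuousOn_iff_continuous_domRestrict.2 (continuous_subtype_val.comp hloc.continuous)

theorem IsStatistic.measurable (hS : IsStatistic Θ ξ P S 𝕊 Sinf) (hξ : ∀ t, Measurable (ξ t))
    (T : ℕ) (hT : 1 ≤ T) : Measurable (S T) :=
  (hS.adapted T hT).mono (history_le hξ T) le_rfl

/-- The rate function vanishes at the limit in probability of the statistic. -/
theorem rate_eq_zero (hP : IsAmbiguitySet Θ P) (hξ : ∀ t, Measurable (ξ t))
    (hS : IsStatistic Θ ξ P S 𝕊 Sinf) (hΛ : HasLimitingLogMGF Θ P S Λ)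
    (hI : IsConjugate 𝕊 Θ Λ I) {θ : Euc d} (hθ : θ ∈ Θ) : I (Sinf θ) θ = 0 := by
  have := hP.isProbabilityMeasure θ hθ
  have h : (I (Sinf θ) θ : EReal) ≤ 0 := by
    rw [hI _ (hS.mapsTo hθ) θ hθ]
    refine iSup_le fun l => ?_
    have hle := inner_le_of_tendstoInMeasure (hS.measurable hξ) (hΛ.tendsto θ hθ l)
      (hS.converges θ hθ)
    exact EReal.sub_nonpos.2 hle
  exact le_antisymm (by exact_mod_cast h) zero_le

theorem rate_lt_ofReal (hP : IsAmbiguitySet Θ P) (hξ : ∀ t, Measurable (ξ t))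
    (hS : IsStatistic Θ ξ P S 𝕊 Sinf) (hΛ : HasLimitingLogMGF Θ P S Λ)
    (hI : IsConjugate 𝕊 Θ Λ I) (hr : 0 < r) {θ : Euc d} (hθ : θ ∈ Θ) :
    I (Sinf θ) θ < ENNReal.ofReal r := by
  rw [rate_eq_zero hP hξ hS hΛ hI hθ]
  exact ENNReal.ofReal_pos.2 hr

theorem tendstoInMeasure_robustPredictor (hP : IsAmbiguitySet Θ P) (hξ : ∀ t, Measurable (ξ t))
    (hc : IsModelPredictor X Θ c) (hS : IsStatistic Θ ξ P S 𝕊 Sinf)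
    (hΛ : HasLimitingLogMGF Θ P S Λ) (hI : IsConjugate 𝕊 Θ Λ I)
    (hreg : IsRegularRateFunction 𝕊 Θ Sinf I) (hr : 0 < r) {x : Euc n} (hx : x ∈ X) {θ : Euc d}
    (hθ : θ ∈ Θ) :
    TendstoInMeasure (P θ) (fun T ω => robustPredictor X 𝕊 Θ c I r x (S T ω)) atTop
      (fun _ => robustPredictor X 𝕊 Θ c I r x (Sinf θ)) := by
  refine tendstoInMeasure_comp_of_continuousWithinAt (hS.converges θ hθ) (hS.ae_mem hθ) ?_
  have h := continuousWithinAt_robustPredictor hc hreg hr hx (hS.mapsTo hθ)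
    (mem_image_of_mem _ hθ) hθ (rate_lt_ofReal hP hξ hS hΛ hI hr hθ)
  exact ContinuousWithinAt.comp (t := X ×ˢ 𝕊) (f := fun s => (x, s)) h
    (by fun_prop : Continuous fun s : Euc d => (x, s)).continuousWithinAt fun s hs => ⟨hx, hs⟩

theorem isDataDrivenPredictor_robustPredictor (hP : IsAmbiguitySet Θ P) (hΘ : Θ.Nonempty)
    (hξ : ∀ t, Measurable (ξ t)) (hc : IsModelPredictor X Θ c)
    (hS : IsStatistic Θ ξ P S 𝕊 Sinf) (hΛ : HasLimitingLogMGF Θ P S Λ)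
    (hI : IsConjugate 𝕊 Θ Λ I) (hreg : IsRegularRateFunction 𝕊 Θ Sinf I) (hr : 0 < r) :
    IsDataDrivenPredictor X Θ ξ P
      (fun T x ω => robustPredictor X 𝕊 Θ c I r x (S T ω)) where
  continuousOn _ _ ω := continuousOn_robustPredictor hc hΘ _
  adapted T hT x hx :=
    (measurable_robustPredictor hc (hreg.levelCompact r hr.le) hx).comp (hS.adapted T hT)
  dominated := by
    obtain ⟨M, hM0, hM⟩ := exists_abs_robustPredictor_le (𝕊 := 𝕊) (I := I) (r := r) hc hΘ
    refine ⟨fun _ => M, measurable_const, fun _ => hM0, fun θ hθ => ?_,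
      fun T _ x hx θ _ => Eventually.of_forall fun ω => hM x hx _⟩
    have := hP.isProbabilityMeasure θ hθ
    exact integrable_const M
  objective_converges := by
    refine ⟨fun x θ => robustPredictor X 𝕊 Θ c I r x (Sinf θ), ?_, fun x hx θ hθ =>
      tendstoInMeasure_robustPredictor hP hξ hc hS hΛ hI hreg hr hx hθ⟩
    refine Continuous.measurable (continuous_iff_continuousAt.2 fun p => ?_)
    have h := continuousWithinAt_robustPredictor hc hreg hr p.1.2 (hS.mapsTo p.2.2)
      (mem_image_of_mem _ p.2.2) p.2.2 (rate_lt_ofReal hP hξ hS hΛ hI hr p.2.2)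
    have hcont : Continuous fun p : X × Θ => ((p.1 : Euc n), Sinf p.2) :=
      (continuous_subtype_val.comp continuous_fst).prodMk
        ((continuousOn_iff_continuous_domRestrict.1 hS.continuousOn).comp continuous_snd)
    exact h.tendsto.comp (tendsto_nhdsWithin_iff.2 ⟨hcont.tendsto p,
      Eventually.of_forall fun q => ⟨q.1.2, hS.mapsTo q.2.2⟩⟩)
  value_converges := by
    have hcw : ∀ θ ∈ Θ, ContinuousWithinAt
        (fun s => ⨅ x : X, robustPredictor X 𝕊 Θ c I r x s) 𝕊 (Sinf θ) := fun θ hθ =>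
      continuousWithinAt_iInf_robustPredictor hc hreg hr (hS.mapsTo hθ) (mem_image_of_mem _ hθ) hθ
        (rate_lt_ofReal hP hξ hS hΛ hI hr hθ)
    refine ⟨fun θ => ⨅ x : X, robustPredictor X 𝕊 Θ c I r x (Sinf θ), ?_, fun θ hθ =>
      tendstoInMeasure_comp_of_continuousWithinAt (hS.converges θ hθ) (hS.ae_mem hθ) (hcw θ hθ)⟩
    refine Continuous.measurable (continuous_iff_continuousAt.2 fun θ => ?_)
    have hcont : Continuous fun θ : Θ => Sinf θ :=
      continuousOn_iff_continuous_domRestrict.1 hS.continuousOn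
    exact (hcw θ θ.2).tendsto.comp (tendsto_nhdsWithin_iff.2 ⟨hcont.tendsto θ,
      Eventually.of_forall fun q => hS.mapsTo q.2⟩)

/-- The out-of-sample disappointment of the robust predictor decays at the rate `r`. -/
theorem disappointment_robustPredictor (hξ : ∀ t, Measurable (ξ t)) (hc : IsModelPredictor X Θ c)
    (hS : IsStatistic Θ ξ P S 𝕊 Sinf) (hΛ : HasLimitingLogMGF Θ P S Λ)
    (hI : IsConjugate 𝕊 Θ Λ I) (hreg : IsRegularRateFunction 𝕊 Θ Sinf I) (hr : 0 < r)
    {x : Euc n} (hx : x ∈ X) {θ : Euc d} (hθ : θ ∈ Θ) :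
    limsup (fun T : ℕ => ((1 / (T : ℝ) : ℝ) : EReal) *
      ENNReal.log (P θ {ω | robustPredictor X 𝕊 Θ c I r x (S T ω) < c x θ})) atTop ≤
        ((-r : ℝ) : EReal) := by
  have hcpt := hreg.levelCompact r hr.le
  set K : Set (Euc d) := Prod.fst '' sublevel 𝕊 Θ I r with hK
  have hKc : IsCompact K := hcpt.image continuous_fst
  have hK𝕊 : K ⊆ 𝕊 := by
    rintro _ ⟨p, hp, rfl⟩
    exact hp.1.1
  have hD : IsCompact (K ∩ (fun s => I s θ) ⁻¹' Ici (ENNReal.ofReal r)) := by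
    refine hKc.of_isClosed_subset (ContinuousOn.preimage_isClosed_of_isClosed
      (fun s hs => ?_) hKc.isClosed isClosed_Ici) inter_subset_left
    exact (hreg.tendsto_left (hK𝕊 hs) hθ).mono_left (nhdsWithin_mono _ hK𝕊)
  -- Outside `K` the worst case runs over all of `closure Θ` and cannot disappoint; inside `K`,
  -- disappointment excludes `θ` from the slice.
  have hsub : ∀ s, robustPredictor X 𝕊 Θ c I r x s < c x θ → s ∈ 𝕊 →
      s ∈ K ∩ (fun s => I s θ) ⁻¹' Ici (ENNReal.ofReal r) := by
    intro s hs hs𝕊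
    rw [← hc.extendedCost_eq hx hθ] at hs
    have hnot : θ ∉ ambiguity 𝕊 Θ I r s :=
      fun h => hs.not_ge (extendedCost_le_robustPredictor hc hx h)
    have hsK : s ∈ K := by
      by_contra hsK
      rw [ambiguity_of_notMem_image hsK] at hnot
      exact hnot (subset_closure hθ)
    refine ⟨hsK, ?_⟩
    by_contra hlt
    have hmem : (s, θ) ∈ sublevel 𝕊 Θ I r := ⟨⟨hs𝕊, subset_closure hθ⟩, (not_le.1 hlt).le⟩
    rw [ambiguity_of_mem hmem] at hnot
    exact hnot hmem
  refine (limsup_le_iff).2 fun y hy => ?_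
  obtain ⟨z, hz, hzy⟩ := EReal.lt_iff_exists_real_btwn.1 hy
  rw [EReal.coe_lt_coe_iff] at hz
  have hrate : ∀ s ∈ K ∩ (fun s => I s θ) ⁻¹' Ici (ENNReal.ofReal r),
      (r : EReal) ≤ ⨆ l, ((inner ℝ l s : ℝ) : EReal) - Λ l θ := by
    intro s hs
    rw [← hI s (hK𝕊 hs.1) θ hθ]
    calc (r : EReal) = ((ENNReal.ofReal r : ℝ≥0∞) : EReal) := by
          rw [EReal.coe_ennreal_ofReal, max_eq_left hr.le]
      _ ≤ _ := EReal.coe_ennreal_le_coe_ennreal_iff.2 hs.2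
  filter_upwards [eventually_measure_compact_lt (hS.measurable hξ) (hΛ.tendsto θ hθ) hD hrate hz,
    eventually_ge_atTop 1] with T hT hT1
  refine lt_trans ((scaledLog_lt_iff hT1 _ z).2 (lt_of_le_of_lt (measure_mono_ae ?_) hT)) hzy
  filter_upwards [hS.ae_mem hθ T hT1] with ω hω h
  exact hsub _ h hω

/-! ### Optimality by change of measure. -/

/-- The limit of a feasible predictor is at least the limit of the robust predictor. -/
theorem IsFeasible.robustPredictor_le (hP : IsAmbiguitySet Θ P) {hξ : ∀ t, Measurable (ξ t)}
    (hc : IsModelPredictor X Θ c) (hS : IsStatistic Θ ξ P S 𝕊 Sinf)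
    (hexp : IsExponentialFamily Θ ξ hξ P S)
    (hΛ : HasLimitingLogMGF Θ P S Λ) (hI : IsConjugate 𝕊 Θ Λ I)
    (hreg : IsRegularRateFunction 𝕊 Θ Sinf I) (hr : 0 < r) {chat : ℕ → Euc n → Ω → ℝ}
    (hchat : IsFeasible X Θ ξ P c r chat) {x : Euc n} (hx : x ∈ X) {θ₀ : Euc d}
    (hθ₀ : θ₀ ∈ Θ) {b : ℝ} (hb : TendstoInMeasure (P θ₀) (fun T => chat T x) atTop fun _ => b) :
    robustPredictor X 𝕊 Θ c I r x (Sinf θ₀) ≤ b := by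
  have := hP.isProbabilityMeasure θ₀ hθ₀
  have hs𝕊 := hS.mapsTo hθ₀
  have hmem : (Sinf θ₀, θ₀) ∈ sublevel 𝕊 Θ I r :=
    ⟨⟨hs𝕊, subset_closure hθ₀⟩, (rate_lt_ofReal hP hξ hS hΛ hI hr hθ₀).le⟩
  have hcont := continuousOn_extendedCost hc hx
  by_contra! hlt
  rw [robustPredictor_eq, ambiguity_of_mem hmem] at hlt
  obtain ⟨_, ⟨θ, hθ, rfl⟩, hbθ⟩ := exists_lt_of_lt_csSup (Nonempty.image _ ⟨θ₀, hmem⟩) hlt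
  -- The model `θ` may lie on the boundary of `Θ` or have rate exactly `r`; radial monotonicity and
  -- continuity of the cost move it to a model where both inequalities are strict.
  obtain ⟨θ₁, hθ₁, hI₁, hbθ₁⟩ : ∃ θ₁ ∈ Θ, I (Sinf θ₀) θ₁ < ENNReal.ofReal r ∧ b < c x θ₁ := by
    have hcl : θ ∈ closure {θ | θ ∈ Θ ∧ I (Sinf θ₀) θ < ENNReal.ofReal r} := by
      rw [hreg.radiallyMonotone _ (mem_image_of_mem _ hθ₀) r hr]
      exact ⟨hθ.1.2, hθ.2⟩
    obtain ⟨U, hU, hU'⟩ := mem_nhdsWithin_iff_exists_mem_nhds_inter.1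
      ((hcont θ hθ.1.2).eventually_const_lt hbθ)
    obtain ⟨θ₁, h1, h2, h3⟩ := mem_closure_iff_nhds.1 hcl U hU
    refine ⟨θ₁, h2, h3, ?_⟩
    have : b < extendedCost X Θ c x θ₁ := hU' ⟨h1, subset_closure h2⟩
    rwa [hc.extendedCost_eq hx h2] at this
  obtain ⟨l, hl⟩ := hexp.exists_changeOfMeasure hP.isProbabilityMeasure hS.adapted hθ₀ hθ₁
  have hΛl : (((inner ℝ l (Sinf θ₀) : ℝ) - r : ℝ) : EReal) < Λ l θ₁ := by
    have h1 : ((inner ℝ l (Sinf θ₀) : ℝ) : EReal) - Λ l θ₁ < (r : EReal) := by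
      refine lt_of_le_of_lt (le_iSup (fun l => ((inner ℝ l (Sinf θ₀) : ℝ) : EReal) - Λ l θ₁) l) ?_
      rw [← hI _ hs𝕊 θ₁ hθ₁]
      calc (I (Sinf θ₀) θ₁ : EReal) < ((ENNReal.ofReal r : ℝ≥0∞) : EReal) :=
            EReal.coe_ennreal_lt_coe_ennreal_iff.2 hI₁
        _ = r := by rw [EReal.coe_ennreal_ofReal, max_eq_left hr.le]
    generalize Λ l θ₁ = w at h1 ⊢
    induction w with
    | bot => simp at h1
    | top => exact EReal.coe_lt_top _
    | coe w =>
      rw [← EReal.coe_sub, EReal.coe_lt_coe_iff] at h1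
      rw [EReal.coe_lt_coe_iff]
      linarith
  -- The constants satisfy `⟨l, Sinf θ₀⟩ < a`, `-r < z`, `L < Λ l θ₁` and `a + z < L`. The last one
  -- yields the contradiction.
  obtain ⟨L, hL', hL⟩ := EReal.lt_iff_exists_real_btwn.1 hΛl
  rw [EReal.coe_lt_coe_iff] at hL'
  obtain ⟨a, ha, haL⟩ := exists_between (show inner ℝ l (Sinf θ₀) < L + r by linarith)
  obtain ⟨z, hz, hzL⟩ := exists_between (show -r < L - a by linarith)
  -- the event on which both the predictor and the statistic are close to their limits
  set F : ℕ → Set Ω := fun T => {ω | chat T x ω < c x θ₁ ∧ inner ℝ l (S T ω) ≤ a} with hF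
  have hFm : ∀ T, 1 ≤ T → MeasurableSet[history ξ T] (F T) := by
    intro T hT
    have h1 := hchat.predictor.adapted T hT x hx
    have h2 := hS.adapted T hT
    have h3 : Measurable[history ξ T] fun ω => (inner ℝ l (S T ω) : ℝ) := by fun_prop
    exact MeasurableSet.inter (measurableSet_lt h1 measurable_const)
      (measurableSet_le h3 measurable_const)
  have hF0 : ∀ᶠ T in atTop, 1 / 2 ≤ P θ₀ (F T) := by
    refine half_lt_measure_of_tendsto_compl ?_
    have h1 := tendsto_measure_notMem_of_tendstoInMeasure hb (Iio_mem_nhds hbθ₁)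
    have h2 := tendsto_measure_notMem_of_tendstoInMeasure (hS.converges θ₀ hθ₀)
      (U := {s | inner ℝ l s ≤ a})
      ((((by fun_prop : Continuous fun s : Euc d => (inner ℝ l s : ℝ)).tendsto
        _).eventually_lt_const ha).mono fun _ h => le_of_lt h)
    have h3 := h1.add h2
    rw [add_zero] at h3
    refine tendsto_of_tendsto_of_tendsto_of_le_of_le tendsto_const_nhds h3 (fun _ => zero_le)
      fun T => (measure_mono fun ω hω => ?_).trans (measure_union_le _ _)
    by_contra hcon
    simp only [mem_union, mem_ofPred_eq, mem_Iio, not_or, not_not] at hcon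
    exact hω hcon
  have hdis := ((limsup_le_iff).1 (hchat.disappointment x hx θ₁ hθ₁)) z
    (EReal.coe_lt_coe_iff.2 hz)
  have hM := (hΛ.tendsto θ₁ hθ₁ l).eventually_const_lt hL
  obtain ⟨T, hF0, hdis, hM, hT2, hT⟩ := (hF0.and (hdis.and (hM.and
    ((eventually_const_lt_exp (sub_pos.2 hzL) (C := 2) (by simp)).and
      (eventually_ge_atTop 1))))).exists
  rw [scaledLog_lt_iff hT] at hdis
  rw [logMGF, lt_scaledLog_iff hT] at hM
  have hupper : ∫⁻ ω in F T, ENNReal.ofReal (Real.exp (inner ℝ ((T : ℝ) • l) (S T ω))) ∂(P θ₁) ≤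
      ENNReal.ofReal (Real.exp (T * a)) * P θ₁ (F T) := by
    rw [← setLIntegral_const]
    refine setLIntegral_mono measurable_const fun ω hω => ?_
    rw [real_inner_smul_left]
    have := hω.2
    gcongr
  have hFle : P θ₁ (F T) ≤ ENNReal.ofReal (Real.exp (T * z)) :=
    (measure_mono fun ω hω => hω.1).trans hdis.le
  -- The tilted mass of `F T` under `θ₁` is at least `exp (T L) / 2`, since `F T` is likely under
  -- `θ₀`, and at most `exp (T (a + z))` by the bound on the statistic and feasibility at `θ₁`.
  have h1 : 1 / 2 * ENNReal.ofReal (Real.exp (T * L)) ≤ ENNReal.ofReal (Real.exp (T * (a + z))) :=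
    calc 1 / 2 * ENNReal.ofReal (Real.exp (T * L)) ≤ P θ₀ (F T) * _ := mul_le_mul' hF0 hM.le
      _ = _ := hl T hT (F T) (hFm T hT)
      _ ≤ _ := hupper
      _ ≤ ENNReal.ofReal (Real.exp (T * a)) * ENNReal.ofReal (Real.exp (T * z)) :=
          mul_le_mul_right hFle _
      _ = _ := by rw [← ofReal_exp_add, mul_add]
  rw [show (T : ℝ) * L = T * (L - a - z) + T * (a + z) by ring, ofReal_exp_add, ← mul_assoc] at h1
  have h2 : 1 / 2 * ENNReal.ofReal (Real.exp (T * (L - a - z))) ≤ 1 :=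
    (ENNReal.mul_le_mul_iff_left (ofReal_exp_ne_zero _) ENNReal.ofReal_ne_top).1 (by simpa using h1)
  have h3 : (1 / 2 : ℝ≥0∞) * 2 < 1 / 2 * ENNReal.ofReal (Real.exp (T * (L - a - z))) :=
    (ENNReal.mul_lt_mul_iff_right (by simp) (by simp)).2 hT2
  rw [one_div, ENNReal.inv_mul_cancel (by simp) (by simp), ← one_div] at h3
  exact h3.not_ge h2

end DataDriven

theorem mainTheorem3 {Ω : Type*} [MeasurableSpace Ω] {n m d : ℕ}
    (X : Set (DataDriven.Euc n)) (hX : IsCompact X)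
    (ξ : ℕ → Ω → DataDriven.Euc m) (hξ : ∀ t, Measurable (ξ t))
    (Θ : Set (DataDriven.Euc d)) (P : DataDriven.Euc d → MeasureTheory.Measure Ω)
    (hP : DataDriven.IsAmbiguitySet Θ P)
    (c : DataDriven.Euc n → DataDriven.Euc d → ℝ) (hc : DataDriven.IsModelPredictor X Θ c)
    (S : ℕ → Ω → DataDriven.Euc d) (𝕊 : Set (DataDriven.Euc d))
    (Sinf : DataDriven.Euc d → DataDriven.Euc d)
    (hS : DataDriven.IsStatistic Θ ξ P S 𝕊 Sinf)
    (hexp : DataDriven.IsExponentialFamily Θ ξ hξ P S)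
    (Λ : DataDriven.Euc d → DataDriven.Euc d → EReal)
    (hΛ : DataDriven.HasLimitingLogMGF Θ P S Λ)
    (I : DataDriven.Euc d → DataDriven.Euc d → ENNReal)
    (hI : DataDriven.IsConjugate 𝕊 Θ Λ I)
    (hreg : DataDriven.IsRegularRateFunction 𝕊 Θ Sinf I)
    (r : ℝ) (hr : 0 < r) :
    DataDriven.IsParetoDominant X Θ ξ P c r
      (fun T x ω => DataDriven.robustPredictor X 𝕊 Θ c I r x (S T ω)) := by
  -- The baseline model shows that `Θ` is nonempty; `id` keeps `hexp` in the context.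
  obtain ⟨θbar, hθbar, -⟩ := id hexp
  have hpred := DataDriven.isDataDrivenPredictor_robustPredictor hP ⟨θbar, hθbar⟩ hξ hc hS hΛ hI
    hreg hr
  have hlim : ∀ chat, DataDriven.IsDataDrivenPredictor X Θ ξ P chat → ∀ x ∈ X, ∀ θ ∈ Θ, ∀ b : ℝ,
      TendstoInMeasure (P θ) (fun T => chat T x) atTop (fun _ => b) →
      Tendsto (fun T : ℕ => ∫ ω, chat T x ω ∂(P θ)) atTop (𝓝 b) := by
    intro chat hchat x hx θ hθ b hb
    obtain ⟨cbar, -, -, hint, hbound⟩ := hchat.dominated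
    have := hP.isProbabilityMeasure θ hθ
    exact DataDriven.tendsto_integral_of_tendstoInMeasure_const hb
      (fun T hT => ((hchat.adapted T hT x hx).mono (DataDriven.history_le hξ T)
        le_rfl).aestronglyMeasurable) (hint θ hθ) (fun T hT => hbound T hT x hx θ hθ)
  refine ⟨⟨hpred, fun x hx θ hθ =>
    DataDriven.disappointment_robustPredictor hξ hc hS hΛ hI hreg hr hx hθ⟩, ?_⟩
  intro chat hchat x hx θ hθ
  obtain ⟨cinf, -, hcinf⟩ := hchat.predictor.objective_converges
  exact ⟨DataDriven.robustPredictor X 𝕊 Θ c I r x (Sinf θ), cinf x θ,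
    hlim _ hpred x hx θ hθ _
      (DataDriven.tendstoInMeasure_robustPredictor hP hξ hc hS hΛ hI hreg hr hx hθ),
    hlim _ hchat.predictor x hx θ hθ _ (hcinf x hx θ hθ),
    hchat.robustPredictor_le hP hc hS hexp hΛ hI hreg hr hx hθ (hcinf x hx θ hθ)⟩
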